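/- Let $\mathfrak g$ be a finite-dimensional simple Lie algebra over $\mathbb C$ with a non-degenerate symmetric invariant bilinear form $(\cdot,\cdot)$, let $\mathfrak h$ be a Cartan subalgebra, $\overset{\circ}{\Delta}$ the set of roots of $(\mathfrak g,\mathfrak h)$, $\overset{\circ}{\Delta}{}^{+}$ a system of positive roots with simple roots $\alpha_1,\dots,\alpha_\ell$, and $\beta$ the highest root. Let $$\tilde{\mathfrak g}=\mathfrak g\otimes\mathbb C[t,t^{-1}]\oplus\mathbb CK,\qquad \tau=\bigoplus_{n\in\mathbb Z}\mathbb CL_n\oplus\tilde{\mathfrak g},$$ where $\tau$ is the Lie algebra with $K$ central and $$[X\otimes t^n,Y\otimes t^m]=[X,Y]\otimes t^{n+m}+n\,\delta_{n+m,0}(X,Y)K,\qquad [L_n,X\otimes t^m]=m\,X\otimes t^{n+m},$$ $$[L_n,L_m]=(m-n)L_{n+m}+\delta_{n+m,0}\tfrac{n^3-n}{12}K,$$ so that $\tau$ is the semidirect product of the Virasoro algebra and $\tilde{\mathfrak g}$ with the two central elements identified. Let $A$ be a finitely generated commutative associative unital $\mathbb C$-algebra, $\tau(A)=\tau\otimes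 A$ with bracket $[X\otimes a,Y\otimes b]=[X,Y]\otimes ab$, and write $X(a)=X\otimes a$; an element $X\in\tau$ acts on $\tau(A)$-modules as $X(1)$. Put $d=L_0$ and $\bar{\mathfrak h}=\mathfrak h\oplus\mathbb CK\oplus\mathbb Cd$. Extend $(\cdot,\cdot)$ from $\mathfrak h$ to $\bar{\mathfrak h}$ by $(K,d)=1$, $(K,K)=(d,d)=0$, $(\mathfrak h,K)=(\mathfrak h,d)=0$; let $\gamma:\bar{\mathfrak h}\to\bar{\mathfrak h}^*$, $\gamma(h_1)(h_2)=(h_1,h_2)$, be the resulting isomorphism, and denote again by $(\cdot,\cdot)$ the form it induces on $\bar{\mathfrak h}^*$. Roots of $\mathfrak g$ are extended to $\bar{\mathfrak h}$ by $0$ on $K$ and $d$; let $\delta\in\bar{\mathfrak h}^*$ with $\delta(\mathfrak h)=\delta(K)=0$, $\delta(d)=1$, and $\alpha_0=\delta-\beta$. Let $\Delta=\{\alpha+n\delta,\ m\delta:\alpha\in\overset{\circ}{\Delta},\ n,m\in\mathbb Z,\ m\ne0\}$, with positive roots $\Delta^+$ consisting of $\alpha+n\delta$ ($n>0$, or $n=0$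 and $\alpha\in\overset{\circ}{\Delta}{}^{+}$) and $m\delta$ ($m>0$); the height $\operatorname{ht}$ of a root is the sum of its coefficients with respect to $\alpha_0,\dots,\alpha_\ell$. For $\lambda\in\bar{\mathfrak h}^*$ let $\tau_\lambda=\{X\in\tau:[h,X]=\lambda(h)X\ \forall h\in\bar{\mathfrak h}\}$. A $\tau(A)$-module $V$ is in category $\mathcal O$ if 1. $V=\bigoplus_{\lambda\in\bar{\mathfrak h}^*}V_\lambda$, where $V_\lambda=\{v\in V: hv=\lambda(h)v\ \forall h\in\bar{\mathfrak h}\}$ is finite-dimensional for every $\lambda$; 2. for all $v\in V$ and $a\in A$ there is $N$ such that $X(a)v=0$ for all $\alpha\in\Delta^+$ with $\operatorname{ht}\alpha\ge N$ and all $X\in\tau_\alpha$. Let $\rho\in\bar{\mathfrak h}^*$ satisfy $(\rho,\alpha_i)=\tfrac12(\alpha_i,\alpha_i)$ for $0\le i\le\ell$. Let $\{h_i\}$ and $\{h^i\}$ be dual bases of $\mathfrak h$, i.e. $(h_i,h^j)=\delta_{ij}$, and let $x_\alpha\in\mathfrak g_\alpha$ ($\alpha\in\overset{\circ}{\Delta}$)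 be root vectors with $(x_\alpha,x_{-\alpha})=1$. For $a,b\in A$ put $$\Omega^1_{a,b}=\sum_{\alpha\in\overset{\circ}{\Delta}}\sum_{n>0}x_{-\alpha}\otimes t^{-n}(a)\;x_\alpha\otimes t^n(b),\qquad \Omega^2_{a,b}=\sum_i\sum_{n>0}h_i\otimes t^{-n}(a)\;h^i\otimes t^n(b),\qquad \Omega^3_{a,b}=\sum_{\alpha\in\overset{\circ}{\Delta}{}^{+}}x_{-\alpha}(a)\,x_\alpha(b),$$ $$\Omega(a,b)=2\gamma^{-1}(\rho)(ab)+\sum_ih_i(a)h^i(b)+K(a)d(b)+K(b)d(a)+\Omega^1_{a,b}+\Omega^1_{b,a}+\Omega^2_{a,b}+\Omega^2_{b,a}+\Omega^3_{a,b}+\Omega^3_{b,a}.$$ **Proposition.** Let $V$ be a $\tau(A)$-module in category $\mathcal O$ and $a,b\in A$. For every $v\in V$ only finitely many terms of the sums defining $\Omega(a,b)v$ are non-zero, so $\Omega(a,b)$ is a well-defined linear operator on $V$; and it commutes with the action of $\tilde{\mathfrak g}$: $\Omega(a,b)\,Xv=X\,\Omega(a,b)v$ for all $X\in\tilde{\mathfrak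 g}$, $v\in V$. -/

import Mathlib

open scoped TensorProduct

noncomputable section

namespace AffVir

section LieAlgebraTau

/-- A non-degenerate symmetric invariant bilinear form on a complex Lie algebra. -/
structure InvForm (g : Type*) [LieRing g] [LieAlgebra ℂ g] where
  form : LinearMap.BilinForm ℂ g
  symm : ∀ x y, form x y = form y x
  inv : ∀ x y z, form ⁅x, y⁆ z = form x ⁅y, z⁆
  nondeg : form.Nondegenerate

variable {g : Type*} [LieRing g] [LieAlgebra ℂ g]

/-- The vector space `⨁ ℂ Lₙ ⊕ (g ⊗ ℂ[t, t⁻¹]) ⊕ ℂ K` underlying the affine-Virasoro algebra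
`τ = (Vir ⋉ g̃) / ℂ (K - C₀)`: a triple consists of the coefficients of the `Lₙ`, the coefficients
(in `g`) of the `tⁿ`, and the coefficient of `K = C₀`. The form `B` enters only the bracket. -/
def Tau (_B : InvForm g) : Type _ := (ℤ →₀ ℂ) × (ℤ →₀ g) × ℂ

namespace Tau

variable (B : InvForm g)

instance : AddCommGroup (Tau B) := inferInstanceAs (AddCommGroup ((ℤ →₀ ℂ) × (ℤ →₀ g) × ℂ))

instance : Module ℂ (Tau B) := inferInstanceAs (Module ℂ ((ℤ →₀ ℂ) × (ℤ →₀ g) × ℂ))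

/-- The coefficients of the `Lₙ`. -/
def virPart : Tau B →ₗ[ℂ] (ℤ →₀ ℂ) := LinearMap.fst ℂ (ℤ →₀ ℂ) ((ℤ →₀ g) × ℂ)

/-- The component in `g ⊗ ℂ[t, t⁻¹]`. -/
def loopPart : Tau B →ₗ[ℂ] (ℤ →₀ g) :=
  LinearMap.fst ℂ (ℤ →₀ g) ℂ ∘ₗ LinearMap.snd ℂ (ℤ →₀ ℂ) ((ℤ →₀ g) × ℂ)

/-- The Virasoro generator `Lₙ`. -/
def L (n : ℤ) : Tau B := (Finsupp.single n 1, 0, 0)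

/-- The element `x ⊗ tⁿ`. -/
def X (n : ℤ) : g →ₗ[ℂ] Tau B :=
  LinearMap.inr ℂ (ℤ →₀ ℂ) ((ℤ →₀ g) × ℂ) ∘ₗ LinearMap.inl ℂ (ℤ →₀ g) ℂ ∘ₗ Finsupp.lsingle n

/-- The central element `K`. -/
def K : Tau B := (0, 0, 1)

variable {B} in
theorem induction {p : Tau B → Prop} (hadd : ∀ x y, p x → p y → p (x + y))
    (hsmul : ∀ (c : ℂ) x, p x → p (c • x)) (hL : ∀ n, p (L B n)) (hX : ∀ n x, p (X B n x))
    (hK : p (K B)) (x : Tau B) : p x := by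
  have h0 : p 0 := by simpa using hsmul 0 _ hK
  obtain ⟨u, v, c⟩ := x
  have hu : p (LinearMap.inl ℂ (ℤ →₀ ℂ) ((ℤ →₀ g) × ℂ) u) := by
    induction u using Finsupp.induction_linear with
    | zero => rw [map_zero]; exact h0
    | add u₁ u₂ h₁ h₂ => rw [map_add]; exact hadd _ _ h₁ h₂
    | single n c =>
      rw [← Finsupp.smul_single_one, map_smul]; exact hsmul c _ (hL n)
  have hv : p (LinearMap.inr ℂ (ℤ →₀ ℂ) ((ℤ →₀ g) × ℂ) (LinearMap.inl ℂ (ℤ →₀ g) ℂ v)) := by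
    induction v using Finsupp.induction_linear with
    | zero => rw [map_zero, map_zero]; exact h0
    | add u₁ u₂ h₁ h₂ => rw [map_add, map_add]; exact hadd _ _ h₁ h₂
    | single n x => exact hX n x
  have hc : p (c • K B) := hsmul c _ hK
  have := hadd _ _ hu (hadd _ _ hv hc)
  have e : ((u, v, c) : (ℤ →₀ ℂ) × (ℤ →₀ g) × ℂ) =
      (u, 0, 0) + ((0, v, 0) + c • (0, 0, 1)) := by simp
  exact Eq.mpr (congrArg (α := Tau B) p e) this

/-- The bracket of two Virasoro elements,
`[Lₙ, Lₘ] = (m - n) Lₙ₊ₘ + δ_{n+m,0} (n³ - n)/12 · K`. -/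
def brVir : (ℤ →₀ ℂ) →ₗ[ℂ] (ℤ →₀ ℂ) →ₗ[ℂ] Tau B :=
  Finsupp.linearCombination ℂ fun n : ℤ => Finsupp.linearCombination ℂ fun m : ℤ =>
    ((m : ℂ) - n) • L B (n + m) + (if n + m = 0 then ((n : ℂ) ^ 3 - n) / 12 else 0) • K B

/-- The action of Virasoro elements on loops, `[Lₙ, x ⊗ tᵐ] = m x ⊗ tⁿ⁺ᵐ`. -/
def brAct : (ℤ →₀ ℂ) →ₗ[ℂ] (ℤ →₀ g) →ₗ[ℂ] Tau B :=
  Finsupp.linearCombination ℂ fun n : ℤ => Finsupp.lsum ℂ fun m : ℤ => (m : ℂ) • X B (n + m)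

/-- The bracket of two loops,
`[x ⊗ tⁿ, y ⊗ tᵐ] = [x, y] ⊗ tⁿ⁺ᵐ + n δ_{n+m,0} (x, y) K`. -/
def brLoop : (ℤ →₀ g) →ₗ[ℂ] (ℤ →₀ g) →ₗ[ℂ] Tau B :=
  Finsupp.lsum ℂ fun n : ℤ =>
    (Finsupp.lsum ℂ : (ℤ → g →ₗ[ℂ] Tau B) ≃ₗ[ℂ] _).toLinearMap ∘ₗ
      LinearMap.pi fun m : ℤ =>
        (LieModule.toEnd ℂ g g : g →ₗ[ℂ] g →ₗ[ℂ] g).compr₂ (X B (n + m)) +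
          (if n + m = 0 then (n : ℂ) else 0) •
            B.form.compr₂ (LinearMap.toSpanSingleton ℂ (Tau B) (K B))

/-- The bracket of `τ`. -/
def br : Tau B →ₗ[ℂ] Tau B →ₗ[ℂ] Tau B :=
  (brVir B).compl₁₂ (virPart B) (virPart B) + (brAct B).compl₁₂ (virPart B) (loopPart B)
    - ((brAct B).compl₁₂ (virPart B) (loopPart B)).flip
    + (brLoop B).compl₁₂ (loopPart B) (loopPart B)

@[simp] theorem virPart_L (n : ℤ) : virPart B (L B n) = Finsupp.single n 1 := rfl
@[simp] theorem loopPart_L (n : ℤ) : loopPart B (L B n) = 0 := rfl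
@[simp] theorem virPart_X (n : ℤ) (x : g) : virPart B (X B n x) = 0 := rfl
@[simp] theorem loopPart_X (n : ℤ) (x : g) : loopPart B (X B n x) = Finsupp.single n x := rfl
@[simp] theorem virPart_K : virPart B (K B) = 0 := rfl
@[simp] theorem loopPart_K : loopPart B (K B) = 0 := rfl

theorem br_L_L (n m : ℤ) : br B (L B n) (L B m) =
    ((m : ℂ) - n) • L B (n + m) +
      (if n + m = 0 then ((n : ℂ) ^ 3 - n) / 12 else 0) • K B := by
  simp [br, brVir]

theorem br_L_X (n m : ℤ) (x : g) : br B (L B n) (X B m x) = (m : ℂ) • X B (n + m) x := by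
  simp [br, brAct]

theorem br_X_L (n m : ℤ) (x : g) : br B (X B m x) (L B n) = -((m : ℂ) • X B (n + m) x) := by
  simp [br, brAct]

theorem br_X_X (n m : ℤ) (x y : g) : br B (X B n x) (X B m y) =
    X B (n + m) ⁅x, y⁆ + (if n + m = 0 then (n : ℂ) * B.form x y else 0) • K B := by
  by_cases h : n + m = 0 <;> simp [br, brLoop, h, smul_smul]

theorem br_K_left (x : Tau B) : br B (K B) x = 0 := by
  simp [br]

theorem br_K_right (x : Tau B) : br B x (K B) = 0 := by
  simp [br]

theorem br_skew (x y : Tau B) : br B x y = -br B y x := by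
  induction x using Tau.induction with
  | hadd x x' h h' => simp [h, h', add_comm]
  | hsmul c x h => simp [h]
  | hK => simp [br_K_left, br_K_right]
  | hL n =>
    induction y using Tau.induction with
    | hadd x x' h h' => simp [h, h', add_comm]
    | hsmul c x h => simp [h]
    | hK => simp [br_K_left, br_K_right]
    | hX m x => simp [br_L_X, br_X_L]
    | hL m =>
      rw [br_L_L, br_L_L, add_comm m n]
      by_cases h : n + m = 0
      · obtain rfl : m = -n := by omega
        simp only [h, if_true]
        push_cast
        module
      · simp only [h, if_false]
        module
  | hX n x =>
    induction y using Tau.induction with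
    | hadd x x' h h' => simp [h, h', add_comm]
    | hsmul c x h => simp [h]
    | hK => simp [br_K_left, br_K_right]
    | hL m => simp [br_L_X, br_X_L]
    | hX m y =>
      rw [br_X_X, br_X_X, add_comm m n, B.symm y x, ← lie_skew x y, map_neg]
      by_cases h : n + m = 0
      · obtain rfl : m = -n := by omega
        simp only [h, if_true]
        push_cast
        module
      · simp only [h, if_false]
        module

theorem br_leibniz (x y z : Tau B) :
    br B x (br B y z) = br B (br B x y) z + br B y (br B x z) := by
  induction x using Tau.induction with
  | hadd x x' h h' => simp only [map_add, LinearMap.add_apply, h, h']; abel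
  | hsmul c x h => simp only [map_smul, LinearMap.smul_apply, h, smul_add]
  | hK => simp [br_K_left]
  | hL n =>
    induction y using Tau.induction with
    | hadd x x' h h' => simp only [map_add, LinearMap.add_apply, h, h']; abel
    | hsmul c x h => simp only [map_smul, LinearMap.smul_apply, h, smul_add]
    | hK => simp [br_K_left, br_K_right]
    | hL m =>
      induction z using Tau.induction with
      | hadd x x' h h' => simp only [map_add, h, h']; abel
      | hsmul c x h => simp only [map_smul, h, smul_add]
      | hK => simp [br_K_right]
      | hL p =>
        simp only [br_L_L, map_add, map_smul, br_K_right, br_K_left, LinearMap.add_apply,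
          LinearMap.smul_apply]
        rw [show n + m + p = n + (m + p) by ring, show m + (n + p) = n + (m + p) by ring]
        by_cases h : n + (m + p) = 0
        · obtain rfl : p = -n - m := by omega
          simp only [h, if_true]
          push_cast
          module
        · simp only [h, if_false]
          push_cast
          module
      | hX p z =>
        simp only [br_L_L, br_L_X, map_add, map_smul, br_K_left, LinearMap.add_apply,
          LinearMap.smul_apply]
        rw [show n + m + p = n + (m + p) by ring, show m + (n + p) = n + (m + p) by ring]
        push_cast
        module
    | hX m y =>
      induction z using Tau.induction with
      | hadd x x' h h' => simp only [map_add, h, h']; abel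
      | hsmul c x h => simp only [map_smul, h, smul_add]
      | hK => simp [br_K_right]
      | hL p =>
        simp only [br_L_L, br_L_X, br_X_L, map_add, map_smul, map_neg, br_K_right,
          LinearMap.smul_apply]
        rw [show n + p + m = n + (p + m) by ring, show p + (n + m) = n + (p + m) by ring]
        push_cast
        module
      | hX p z =>
        simp only [br_L_X, br_X_X, map_add, map_smul, br_K_right, LinearMap.smul_apply]
        rw [show n + m + p = n + (m + p) by ring, show m + (n + p) = n + (m + p) by ring]
        by_cases h : n + (m + p) = 0
        · obtain rfl : p = -n - m := by omega
          simp only [h, if_true]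
          push_cast
          module
        · simp only [h, if_false]
          push_cast
          module
  | hX n x =>
    induction y using Tau.induction with
    | hadd x x' h h' => simp only [map_add, LinearMap.add_apply, h, h']; abel
    | hsmul c x h => simp only [map_smul, LinearMap.smul_apply, h, smul_add]
    | hK => simp [br_K_left, br_K_right]
    | hL m =>
      induction z using Tau.induction with
      | hadd x x' h h' => simp only [map_add, h, h']; abel
      | hsmul c x h => simp only [map_smul, h, smul_add]
      | hK => simp [br_K_right]
      | hL p =>
        simp only [br_L_L, br_L_X, br_X_L, map_add, map_smul, map_neg, br_K_right,
          LinearMap.neg_apply, LinearMap.smul_apply]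
        rw [show p + (m + n) = m + p + n by ring, show m + (p + n) = m + p + n by ring]
        push_cast
        module
      | hX p z =>
        simp only [br_L_X, br_X_L, br_X_X, map_add, map_smul, map_neg, br_K_right,
          LinearMap.neg_apply, LinearMap.smul_apply]
        rw [show n + (m + p) = m + (n + p) by ring, show m + n + p = m + (n + p) by ring]
        by_cases h : m + (n + p) = 0
        · obtain rfl : p = -n - m := by omega
          simp only [h, if_true]
          push_cast
          module
        · simp only [h, if_false]
          push_cast
          module
    | hX m y =>
      induction z using Tau.induction with
      | hadd x x' h h' => simp only [map_add, h, h']; abel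
      | hsmul c x h => simp only [map_smul, h, smul_add]
      | hK => simp [br_K_right]
      | hL p =>
        simp only [br_X_L, br_X_X, map_add, map_smul, map_neg, br_K_left,
          LinearMap.add_apply, LinearMap.smul_apply]
        rw [show n + (p + m) = p + (n + m) by ring, show m + (p + n) = p + (n + m) by ring,
          B.symm y x, ← lie_skew x y, map_neg]
        by_cases h : p + (n + m) = 0
        · obtain rfl : p = -n - m := by omega
          simp only [h, if_true]
          push_cast
          module
        · simp only [h, if_false]
          push_cast
          module
      | hX p z =>
        simp only [br_X_X, map_add, map_smul, br_K_left, br_K_right, LinearMap.add_apply,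
          LinearMap.smul_apply]
        rw [show n + m + p = n + (m + p) by ring, show m + (n + p) = n + (m + p) by ring,
          leibniz_lie x y z, map_add]
        have e1 : B.form ⁅x, y⁆ z = B.form x ⁅y, z⁆ := B.inv x y z
        have e2 : B.form y ⁅x, z⁆ = -B.form x ⁅y, z⁆ := by
          rw [← B.inv y x z, ← lie_skew y x, map_neg, LinearMap.neg_apply, e1]
        rw [e1, e2]
        by_cases h : n + (m + p) = 0
        · obtain rfl : p = -n - m := by omega
          simp only [h, if_true]
          push_cast
          module
        · simp only [h, if_false]
          module

instance : Bracket (Tau B) (Tau B) := ⟨fun x y => br B x y⟩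

theorem lie_def (x y : Tau B) : ⁅x, y⁆ = br B x y := rfl

instance : LieRing (Tau B) where
  add_lie x y z := by simp [lie_def]
  lie_add x y z := by simp [lie_def]
  lie_self x := by
    have h : (2 : ℂ) • br B x x = 0 := by
      rw [two_smul]
      nth_rewrite 1 [br_skew B x x]
      exact neg_add_cancel _
    exact (smul_eq_zero.mp h).resolve_left two_ne_zero
  leibniz_lie x y z := br_leibniz B x y z

instance : LieAlgebra ℂ (Tau B) where
  lie_smul c x y := by simp [lie_def]

theorem virPart_brLoop (u v : ℤ →₀ g) : virPart B (brLoop B u v) = 0 := by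
  induction u using Finsupp.induction_linear with
  | zero => simp
  | add u₁ u₂ h₁ h₂ => simp [h₁, h₂]
  | single n x =>
    induction v using Finsupp.induction_linear with
    | zero => simp
    | add u₁ u₂ h₁ h₂ => simp only [map_add, h₁, h₂, add_zero]
    | single m y => by_cases h : n + m = 0 <;> simp [brLoop, h]

/-- The affine Lie algebra `g̃ = g ⊗ ℂ[t, t⁻¹] ⊕ ℂ K` inside `τ`. -/
def affine : LieSubalgebra ℂ (Tau B) where
  __ := (virPart B).ker
  lie_mem' := by
    intro x y hx hy
    have hx : virPart B x = 0 := hx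
    have hy : virPart B y = 0 := hy
    change virPart B (br B x y) = 0
    simp [br, hx, hy, virPart_brLoop]

end Tau

end LieAlgebraTau

section Affine

variable {g : Type*} [LieRing g] [LieAlgebra ℂ g] [FiniteDimensional ℂ g] [LieAlgebra.IsSimple ℂ g]
  (B : InvForm g) (H : LieSubalgebra ℂ g) [H.IsCartanSubalgebra]

/-- `h̄ = h ⊕ ℂ K ⊕ ℂ d` with `d = L₀`; the triple `(h, c, e)` stands for `h + c K + e d`. -/
abbrev HBar : Type _ := H × ℂ × ℂ

/-- The embedding of `h̄` into `τ`. -/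
def HBar.toTau : HBar H →ₗ[ℂ] Tau B :=
  (Tau.X B 0 ∘ₗ H.toSubmodule.subtype).coprod
    ((LinearMap.toSpanSingleton ℂ (Tau B) (Tau.K B)).coprod
      (LinearMap.toSpanSingleton ℂ (Tau B) (Tau.L B 0)))

/-- The bilinear form of `h̄`: it extends `( , )` on `h`, both `K` and `d` are isotropic and
orthogonal to `h`, and `(K, d) = 1`. -/
def barForm : LinearMap.BilinForm ℂ (HBar H) :=
  LinearMap.mk₂ ℂ (fun p q => B.form p.1 q.1 + (p.2.1 * q.2.2 + p.2.2 * q.2.1))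
    (fun _ _ _ => by simp; ring) (fun _ _ _ => by simp; ring)
    (fun _ _ _ => by simp; ring) (fun _ _ _ => by simp; ring)

theorem form_cartan_eq_zero (h : H) (hh : ∀ k : H, B.form h k = 0) : h = 0 := by
  have key : ∀ y : g, B.form h y = 0 := by
    intro y
    have hy : y ∈ (H.toLieSubmodule ⊔ ⨆ α : LieModule.Weight ℂ H g, ⨆ (_ : α.IsNonZero),
        LieAlgebra.rootSpace H α : LieSubmodule ℂ H g).toSubmodule := by
      rw [LieAlgebra.cartan_sup_iSup_rootSpace_eq_top]; trivial
    suffices hle : (H.toLieSubmodule ⊔ ⨆ α : LieModule.Weight ℂ H g, ⨆ (_ : α.IsNonZero),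
        LieAlgebra.rootSpace H α : LieSubmodule ℂ H g).toSubmodule ≤ (B.form h).ker from hle hy
    simp only [LieSubmodule.sup_toSubmodule, LieSubmodule.iSup_toSubmodule]
    refine sup_le (fun z hz => hh ⟨z, by simpa using hz⟩) (iSup₂_le fun α hα z hz => ?_)
    obtain ⟨k, hk⟩ : ∃ k : H, (α : H → ℂ) k ≠ 0 := by
      by_contra hcon
      push Not at hcon
      exact hα (funext hcon)
    have h1 : ⁅(k : g), z⁆ = (α : H → ℂ) k • z :=
      LieAlgebra.IsKilling.lie_eq_smul_of_mem_rootSpace hz k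
    have h2 : ⁅(h : g), (k : g)⁆ = 0 := by
      have := congrArg (Subtype.val) (trivial_lie_zero H H h k)
      simpa using this
    have h3 := B.inv (h : g) k z
    rw [h2, h1] at h3
    simp only [map_zero, LinearMap.zero_apply, map_smul, smul_eq_mul] at h3
    exact (mul_eq_zero.mp h3.symm).resolve_left hk
  have := (LinearMap.separatingLeft_iff_ker_eq_bot.mp B.nondeg.1)
  have hm : (h : g) ∈ LinearMap.ker B.form := LinearMap.ext key
  rw [this] at hm
  exact Subtype.ext hm

theorem barForm_nondegenerate : (barForm B H).Nondegenerate := by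
  have hs : ∀ p q, barForm B H p q = barForm B H q p := fun p q => by
    simp only [barForm, LinearMap.mk₂_apply, B.symm p.1 q.1]; ring
  have hl : ∀ p, (∀ q, barForm B H p q = 0) → p = 0 := by
    rintro ⟨h, c, e⟩ hp
    have h1 := hp (0, 0, 1)
    have h2 := hp (0, 1, 0)
    have h3 : h = 0 := form_cartan_eq_zero B H h fun k => by
      simpa [barForm] using hp (k, 0, 0)
    simp [barForm] at h1 h2
    simp [h1, h2, h3]
  exact ⟨hl, fun q hq => hl q fun p => by rw [hs]; exact hq p⟩

/-- The isomorphism `γ : h̄ → h̄*`, `γ(h₁)(h₂) = (h₁, h₂)`. -/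
def gamma : HBar H ≃ₗ[ℂ] Module.Dual ℂ (HBar H) :=
  (barForm B H).toDual (barForm_nondegenerate B H)

theorem gamma_apply (p q : HBar H) : gamma B H p q = barForm B H p q :=
  LinearMap.BilinForm.toDual_def _

/-- The form on `h̄*` induced by `γ`. -/
def dualForm (l m : Module.Dual ℂ (HBar H)) : ℂ :=
  barForm B H ((gamma B H).symm l) ((gamma B H).symm m)

variable {H}

/-- A root of `g`, extended to `h̄` by zero on `K` and `d`. -/
def rootBar (α : H.root) : Module.Dual ℂ (HBar H) :=
  (LieModule.Weight.toLinear ℂ H g α.1) ∘ₗ LinearMap.fst ℂ H (ℂ × ℂ)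

variable (H) in
/-- The null root `δ`: `δ(h) = 0`, `δ(K) = 0`, `δ(d) = 1`. -/
def delta : Module.Dual ℂ (HBar H) :=
  LinearMap.snd ℂ ℂ ℂ ∘ₗ LinearMap.snd ℂ H (ℂ × ℂ)

/-- `β` is the highest root: `β - α` is a sum of simple roots for every root `α`. -/
def IsHighestRoot (S : (LieAlgebra.IsKilling.rootSystem H).Base) (β : H.root) : Prop :=
  ∀ α : H.root, (LieAlgebra.IsKilling.rootSystem H).root β -
    (LieAlgebra.IsKilling.rootSystem H).root α ∈
      AddSubmonoid.closure ((LieAlgebra.IsKilling.rootSystem H).root '' S.support)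

/-- `(ρ, αᵢ) = (αᵢ, αᵢ) / 2` for all simple roots `αᵢ` of the affine algebra, that is, for the simple
roots of `g` and for `α₀ = δ - β`. -/
def IsRho (S : (LieAlgebra.IsKilling.rootSystem H).Base) (β : H.root)
    (ρ : Module.Dual ℂ (HBar H)) : Prop :=
  (∀ i ∈ S.support, dualForm B H ρ (rootBar i) = 1 / 2 * dualForm B H (rootBar i) (rootBar i)) ∧
    dualForm B H ρ (delta H - rootBar β) =
      1 / 2 * dualForm B H (delta H - rootBar β) (delta H - rootBar β)

variable (H) in
/-- The roots of the affine algebra: `α + n δ` with `α` a root of `g`, and `m δ` with `m ≠ 0`. -/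
inductive AffineRoot : Type _
  | real (α : H.root) (n : ℤ) : AffineRoot
  | imag (m : ℤ) (hm : m ≠ 0) : AffineRoot

namespace AffineRoot

/-- The root as a linear form on `h̄`. -/
def toDual : AffineRoot H → Module.Dual ℂ (HBar H)
  | real α n => rootBar α + n • delta H
  | imag m _ => m • delta H

/-- The positive roots: `α + n δ` with `n > 0`, or with `n = 0` and `α` positive; `m δ`, `m > 0`. -/
def IsPos (S : (LieAlgebra.IsKilling.rootSystem H).Base) : AffineRoot H → Prop
  | real α n => 0 < n ∨ n = 0 ∧ S.IsPos α
  | imag m _ => 0 < m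

/-- The height, i.e. the sum of the coefficients with respect to the affine simple roots; as
`δ = α₀ + β`, the height of `δ` is `ht β + 1`. -/
def height (S : (LieAlgebra.IsKilling.rootSystem H).Base) (β : H.root) : AffineRoot H → ℤ
  | real α n => S.height α + n * (S.height β + 1)
  | imag m _ => m * (S.height β + 1)

end AffineRoot

/-- The `h̄`-weight space `τ_l` of `τ` under the adjoint action. -/
def tauWeight (l : Module.Dual ℂ (HBar H)) : Submodule ℂ (Tau B) where
  carrier := {y | ∀ h : HBar H, ⁅HBar.toTau B H h, y⁆ = l h • y}
  add_mem' hx hy h := by rw [lie_add, hx h, hy h, smul_add]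
  zero_mem' h := by simp
  smul_mem' c y hy h := by rw [lie_smul, hy h, smul_comm]

section Module

variable (A : Type*) [CommRing A] [Algebra ℂ A]
  (V : Type*) [AddCommGroup V] [Module ℂ V] [LieRingModule (A ⊗[ℂ] Tau B) V]
  [LieModule ℂ (A ⊗[ℂ] Tau B) V]

variable {B A} in
/-- The operator by which `y(a) = y ⊗ a ∈ τ(A)` acts on the `τ(A)`-module `V`; the Lie algebra
`τ(A) = τ ⊗ A` is written `A ⊗[ℂ] Tau B`. -/
def op (y : Tau B) (a : A) : Module.End ℂ V := LieModule.toEnd ℂ (A ⊗[ℂ] Tau B) V (a ⊗ₜ y)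

/-- The `h̄`-weight space `V_l`. -/
def weightSpace (l : Module.Dual ℂ (HBar H)) : Submodule ℂ V where
  carrier := {v | ∀ h : HBar H, op V (HBar.toTau B H h) (1 : A) v = l h • v}
  add_mem' hx hy h := by rw [map_add, hx h, hy h, smul_add]
  zero_mem' h := by simp
  smul_mem' c y hy h := by rw [map_smul, hy h, smul_comm]

open Classical in
/-- The category `𝒪` of `τ(A)`-modules. -/
structure IsCategoryO (S : (LieAlgebra.IsKilling.rootSystem H).Base) (β : H.root) : Prop where
  isInternal : DirectSum.IsInternal fun l : Module.Dual ℂ (HBar H) => weightSpace B A V l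
  finite : ∀ l : Module.Dual ℂ (HBar H), FiniteDimensional ℂ (weightSpace B A V l)
  locallyNilpotent : ∀ (v : V) (a : A), ∃ N : ℤ, ∀ α : AffineRoot H, α.IsPos S →
    N ≤ α.height S β → ∀ y ∈ tauWeight B α.toDual, op V y a v = 0

variable {A V}

/-- The term `x_{-α} ⊗ t⁻ⁿ(a) x_α ⊗ tⁿ(b)` of `Ω¹` and (for `n = 0`) of `Ω³`. -/
def rootTerm (x : LieModule.Weight ℂ H g → g) (a b : A) (α : LieModule.Weight ℂ H g) (n : ℤ)
    (v : V) : V :=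
  op V (Tau.X B (-n) (x (-α))) a (op V (Tau.X B n (x α)) b v)

/-- The term `h ⊗ t⁻ⁿ(a) h' ⊗ tⁿ(b)` of `Ω²` and (for `n = 0`) of the Cartan part. -/
def cartanTerm (h h' : H) (a b : A) (n : ℤ) (v : V) : V :=
  op V (Tau.X B (-n) h) a (op V (Tau.X B n h') b v)

/-- `Ω¹_{a,b} = ∑_α ∑_{n > 0} x_{-α} ⊗ t⁻ⁿ(a) x_α ⊗ tⁿ(b)`. -/
def omega1 (x : LieModule.Weight ℂ H g → g) (a b : A) (v : V) : V :=
  ∑ α : H.root, ∑ᶠ n : ℕ+, rootTerm B x a b α n v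

/-- `Ω²_{a,b} = ∑_i ∑_{n > 0} h_i ⊗ t⁻ⁿ(a) hⁱ ⊗ tⁿ(b)`. -/
def omega2 {ι : Type*} [Fintype ι] (h h' : ι → H) (a b : A) (v : V) : V :=
  ∑ i, ∑ᶠ n : ℕ+, cartanTerm B (h i) (h' i) a b n v

open Classical in
/-- `Ω³_{a,b} = ∑_{α > 0} x_{-α}(a) x_α(b)`. -/
def omega3 (S : (LieAlgebra.IsKilling.rootSystem H).Base) (x : LieModule.Weight ℂ H g → g)
    (a b : A) (v : V) : V :=
  ∑ α : H.root with S.IsPos α, rootTerm B x a b α 0 v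

/-- `Ω(a,b) = 2 γ⁻¹(ρ)(ab) + ∑ h_i(a) hⁱ(b) + K(a) d(b) + K(b) d(a) + Ω¹_{a,b} + Ω¹_{b,a} + Ω²_{a,b}
+ Ω²_{b,a} + Ω³_{a,b} + Ω³_{b,a}`, with `d = L₀`, as a map `V → V`. -/
def omega (S : (LieAlgebra.IsKilling.rootSystem H).Base) (ρ : Module.Dual ℂ (HBar H))
    (x : LieModule.Weight ℂ H g → g) {ι : Type*} [Fintype ι] (h h' : ι → H)
    (a b : A) (v : V) : V :=
  (2 : ℂ) • op V (HBar.toTau B H ((gamma B H).symm ρ)) (a * b) v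
    + ∑ i, cartanTerm B (h i) (h' i) a b 0 v
    + op V (Tau.K B) a (op V (Tau.L B 0) b v) + op V (Tau.K B) b (op V (Tau.L B 0) a v)
    + omega1 B x a b v + omega1 B x b a v
    + omega2 B h h' a b v + omega2 B h h' b a v
    + omega3 B S x a b v + omega3 B S x b a v

end Module

end Affine

end AffVir

end

/-! Up to explicit corrections, `Ω(a,b)` is the normally ordered sum of the modes `∑ᵢ uᵢ ⊗ t⁻ⁿ(a)
u'ᵢ ⊗ tⁿ(b)`, where `u`, `u'` are the dual bases of `g` made of `h_i`, `hⁱ` and root vectors. Write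
`γ⁻¹(ρ) = k + cK + ed`. Reordering the zero mode so that positive root vectors act first produces
the sum of the `γ⁻¹(α)` over the positive roots of `g`, which is `2k`. Hence `Ω(a,b)` is the
Sugawara sum plus `K(a)d(b) + K(b)d(a) + 2c K(ab) + 2e d(ab)` (`IsLoopRestricted.omega_eq`).

The commutator of `y ⊗ tᵐ` with the Sugawara sum has two parts (`IsLoopRestricted.op_sugawara`). The
central terms of the loop bracket give `m (K(a) y⊗tᵐ(b) + K(b) y⊗tᵐ(a))`. The remaining terms
telescope in the mode index, by invariance of `∑ uᵢ ⊗ u'ᵢ`, and leave `m` copies of `(Cy) ⊗ tᵐ(ab)`,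
with `C` the Casimir operator of the adjoint representation.

Since `[y ⊗ tᵐ, d] = -m y ⊗ tᵐ`, the first part cancels against `K(a)d(b) + K(b)d(a)`, and the
second against `2e d(ab)` provided that `C = 2e`. As `g` is simple, `C` is a scalar, computed on a
highest root vector as `(β, β + 2ρ)`; the condition on `ρ` at `α₀ = δ - β` says precisely that this
number is `2e` (`casimir_root_eq_smul`, `IsRho.two_mul_derivation_part`).

Category `𝒪` enters only through the fact that each vector is killed by `z ⊗ tⁿ(a)` for all large
`n`, uniformly in `z` (`IsCategoryO.isLoopRestricted`), which makes all sums finite. -/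

noncomputable section

namespace AffVir

/-! ### Dual bases and the Casimir operator of the adjoint representation. -/

section DualFamilies

variable {g : Type*} [LieRing g] [LieAlgebra ℂ g] (B : InvForm g) {κ : Type*} [Fintype κ]

/-- Two finite families are dual for the form: `z = ∑ᵢ (z, uᵢ) u'ᵢ` for all `z`. -/
def IsDualFamily (u u' : κ → g) : Prop := ∀ z, ∑ i, B.form z (u i) • u' i = z

variable {B} {u u' : κ → g} {M : Type*} [AddCommGroup M] [Module ℂ M]

theorem InvForm.eq_zero_of_forall {z : g} (hz : ∀ w, B.form z w = 0) : z = 0 := B.nondeg.1 z hz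

theorem InvForm.form_lie_left (y z w : g) : B.form ⁅y, z⁆ w = -B.form z ⁅y, w⁆ := by
  rw [← lie_skew y z, map_neg, LinearMap.neg_apply, B.inv]

/-- Expanding `w` turns `(z, w)` into `∑ (w, uᵢ)(z, u'ᵢ)`, so `∑ (z, u'ᵢ) uᵢ - z` is orthogonal to
every `w`. -/
theorem IsDualFamily.symm (hu : IsDualFamily B u u') : IsDualFamily B u' u := by
  intro z
  rw [← sub_eq_zero]
  refine InvForm.eq_zero_of_forall (B := B) fun w => ?_
  have h1 : B.form z w = ∑ i, B.form w (u i) * B.form z (u' i) := by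
    conv_lhs => rw [← hu w]
    simp
  rw [map_sub, LinearMap.sub_apply, h1]
  simp [LinearMap.sum_apply, B.symm w, mul_comm]

/-- The tensor `∑ uᵢ ⊗ u'ᵢ` is symmetric because the form is. -/
theorem IsDualFamily.sum_swap (hu : IsDualFamily B u u') (φ : g →ₗ[ℂ] g →ₗ[ℂ] M) :
    ∑ i, φ (u i) (u' i) = ∑ i, φ (u' i) (u i) := by
  have h1 : ∀ i, φ (u i) (u' i) = ∑ j, B.form (u i) (u j) • φ (u' j) (u' i) := fun i => by
    conv_lhs => rw [← hu (u i)]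
    simp [LinearMap.sum_apply]
  have h2 : ∀ j, φ (u' j) (u j) = ∑ i, B.form (u j) (u i) • φ (u' j) (u' i) := fun j => by
    conv_lhs => rw [← hu (u j)]
    simp
  simp_rw [h1, h2]
  rw [Finset.sum_comm]
  simp_rw [B.symm]

/-- The tensor `∑ uᵢ ⊗ u'ᵢ` is killed by `y`, because the form is invariant. -/
theorem IsDualFamily.sum_lie (hu : IsDualFamily B u u') (φ : g →ₗ[ℂ] g →ₗ[ℂ] M) (y : g) :
    ∑ i, φ ⁅y, u i⁆ (u' i) = -∑ i, φ (u i) ⁅y, u' i⁆ := by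
  have h1 : ∀ i, φ ⁅y, u i⁆ (u' i) = ∑ j, B.form ⁅y, u i⁆ (u' j) • φ (u j) (u' i) := fun i => by
    conv_lhs => rw [← hu.symm ⁅y, u i⁆]
    simp [LinearMap.sum_apply]
  have h2 : ∀ j, φ (u j) ⁅y, u' j⁆ = ∑ i, B.form ⁅y, u' j⁆ (u i) • φ (u j) (u' i) := fun j => by
    conv_lhs => rw [← hu ⁅y, u' j⁆]
    simp
  simp_rw [h1, h2, ← Finset.sum_neg_distrib, ← neg_smul]
  rw [Finset.sum_comm]
  refine Finset.sum_congr rfl fun j _ => Finset.sum_congr rfl fun i _ => ?_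
  rw [InvForm.form_lie_left, B.symm]

/-- The Casimir operator of the adjoint representation. -/
def casimir (u u' : κ → g) : g →ₗ[ℂ] g :=
  ∑ i, (LieAlgebra.ad ℂ g (u i) : g →ₗ[ℂ] g) ∘ₗ LieAlgebra.ad ℂ g (u' i)

theorem casimir_apply (y : g) : casimir u u' y = ∑ i, ⁅u i, ⁅u' i, y⁆⁆ := by
  simp [casimir, LinearMap.sum_apply]

theorem casimir_lie (hu : IsDualFamily B u u') (y z : g) :
    casimir u u' ⁅y, z⁆ = ⁅y, casimir u u' z⁆ := by
  let φ : g →ₗ[ℂ] g →ₗ[ℂ] g := LinearMap.mk₂ ℂ (fun a b => ⁅a, ⁅b, z⁆⁆)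
    (by simp) (by simp) (by simp) (by simp)
  have h := hu.sum_lie φ y
  simp only [φ, LinearMap.mk₂_apply] at h
  rw [casimir_apply, casimir_apply, lie_sum]
  have h3 : ∀ i, ⁅y, ⁅u i, ⁅u' i, z⁆⁆⁆ =
      ⁅⁅y, u i⁆, ⁅u' i, z⁆⁆ + ⁅u i, ⁅⁅y, u' i⁆, z⁆⁆ + ⁅u i, ⁅u' i, ⁅y, z⁆⁆⁆ := fun i => by
    rw [leibniz_lie y (u i), leibniz_lie y (u' i), lie_add, add_assoc]
  simp_rw [h3, Finset.sum_add_distrib, h]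
  simp

/-- A form of Schur's lemma: the kernel of `C - c` is an ideal since `C` commutes with the adjoint
action, and it contains the nonzero vector `x₀`. -/
theorem casimir_eq_smul [LieAlgebra.IsSimple ℂ g] (hu : IsDualFamily B u u') {x₀ : g}
    (hx₀ : x₀ ≠ 0) {c : ℂ} (hc : casimir u u' x₀ = c • x₀) (y : g) :
    casimir u u' y = c • y := by
  let I : LieIdeal ℂ g :=
    { LinearMap.ker (casimir u u' - c • LinearMap.id) with
      lie_mem := by
        intro a b hb
        have hb : casimir u u' b - c • b = 0 := hb
        change casimir u u' ⁅a, b⁆ - c • ⁅a, b⁆ = 0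
        rw [casimir_lie hu, ← lie_smul, ← lie_sub, hb, lie_zero] }
  have hI : I = ⊤ := by
    refine (LieAlgebra.IsSimple.eq_bot_or_eq_top I).resolve_left fun h => hx₀ ?_
    have : x₀ ∈ I := sub_eq_zero.mpr hc
    rw [h] at this
    exact (LieSubmodule.mem_bot x₀).mp this
  have : y ∈ I := by rw [hI]; trivial
  exact sub_eq_zero.mp this

end DualFamilies

/-! ### Roots and coroots in terms of the given form; the sum of the positive roots. -/

section Roots

open LieAlgebra LieAlgebra.IsKilling LieModule

variable {g : Type*} [LieRing g] [LieAlgebra ℂ g] [FiniteDimensional ℂ g] [LieAlgebra.IsSimple ℂ g]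
  (B : InvForm g) (H : LieSubalgebra ℂ g) [H.IsCartanSubalgebra]

/-- The restriction of the form to the Cartan subalgebra. -/
def cartanForm : LinearMap.BilinForm ℂ H :=
  B.form.compl₁₂ H.toSubmodule.subtype H.toSubmodule.subtype

theorem cartanForm_nondegenerate : (cartanForm B H).Nondegenerate :=
  ⟨fun h hh => form_cartan_eq_zero B H h hh,
    fun h hh => form_cartan_eq_zero B H h fun k => (B.symm _ _).trans (hh k)⟩

/-- A weight as a linear form on the Cartan subalgebra. -/
abbrev rootLin {H : LieSubalgebra ℂ g} [H.IsCartanSubalgebra] (α : LieModule.Weight ℂ H g) :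
    Module.Dual ℂ H :=
  LieModule.Weight.toLinear ℂ H g α

/-- The isomorphism `h* → h` given by the form. -/
def tee : Module.Dual ℂ H ≃ₗ[ℂ] H := ((cartanForm B H).toDual (cartanForm_nondegenerate B H)).symm

theorem form_tee (l : Module.Dual ℂ H) (k : H) : B.form (tee B H l) k = l k := by
  have : (cartanForm B H).toDual (cartanForm_nondegenerate B H) (tee B H l) = l :=
    LinearEquiv.apply_symm_apply _ l
  conv_rhs => rw [← this]
  rfl

theorem apply_tee_comm (l m : Module.Dual ℂ H) : l (tee B H m) = m (tee B H l) := by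
  rw [← form_tee B H l, B.symm, form_tee]

variable {B H}

theorem tee_eq_iff {l : Module.Dual ℂ H} {h : H} : h = tee B H l ↔ ∀ k : H, B.form h k = l k := by
  refine ⟨fun e k => e ▸ form_tee B H l k, fun e => sub_eq_zero.mp ?_⟩
  refine form_cartan_eq_zero B H _ fun k => ?_
  simp [e, form_tee]

theorem form_eq_zero_of_rootSpace {α β : H → ℂ} {y z : g} (hy : y ∈ rootSpace H α)
    (hz : z ∈ rootSpace H β) (hαβ : α + β ≠ 0) : B.form y z = 0 := by
  obtain ⟨k, hk⟩ : ∃ k, α k + β k ≠ 0 := by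
    by_contra! h
    exact hαβ (funext h)
  have h1 : ⁅(k : g), y⁆ = α k • y := lie_eq_smul_of_mem_rootSpace hy k
  have h2 : ⁅(k : g), z⁆ = β k • z := lie_eq_smul_of_mem_rootSpace hz k
  have h3 := InvForm.form_lie_left (B := B) k y z
  rw [h1, h2] at h3
  simp only [map_smul, LinearMap.smul_apply, smul_eq_mul] at h3
  have : (α k + β k) * B.form y z = 0 := by linear_combination h3
  exact (mul_eq_zero.mp this).resolve_left hk

/-- The bracket lies in the Cartan subalgebra, and invariance computes its pairing with `k` as `(y,
z) α(k)`. -/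
theorem lie_rootSpace_neg {α : Weight ℂ H g} {y z : g} (hy : y ∈ rootSpace H α)
    (hz : z ∈ rootSpace H (-α)) :
    ⁅y, z⁆ = B.form y z • (tee B H (rootLin α) : g) := by
  have h1 : ⁅y, z⁆ ∈ H := by
    have := LieAlgebra.lie_mem_genWeightSpace_of_mem_genWeightSpace hy hz
    simpa using this
  have h2 : (⟨⁅y, z⁆, h1⟩ : H) = B.form y z • tee B H (rootLin α) := by
    rw [← map_smul, tee_eq_iff]
    intro k
    have h3 : ⁅(k : g), y⁆ = α k • y := lie_eq_smul_of_mem_rootSpace hy k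
    rw [B.symm, ← B.inv, h3]
    simp [mul_comm]
  exact congrArg Subtype.val h2

/-- An `sl₂`-triple shows that the coroot is a multiple of `tee α`; the factor is fixed by the value
`2` of `α` on its coroot. -/
theorem two_mul_apply_tee {α : Weight ℂ H g} (hα : α.IsNonZero) (l : Module.Dual ℂ H) :
    2 * l (tee B H (rootLin α)) = α (tee B H (rootLin α)) * l (coroot α) := by
  obtain ⟨h, e, f, ht, he, hf⟩ := exists_isSl2Triple_of_weight_isNonZero hα
  have h1 := ht.h_eq_coroot hα he hf
  rw [← ht.lie_e_f, lie_rootSpace_neg (B := B) he hf] at h1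
  have h2 : coroot α = B.form e f • tee B H (rootLin α) := (Subtype.ext h1).symm
  have h3 := root_apply_coroot hα
  have h4 : rootLin α (coroot α) = 2 := h3
  rw [h2, map_smul, smul_eq_mul] at h4
  have h5 : α (tee B H (rootLin α)) = rootLin α (tee B H (rootLin α)) := rfl
  rw [h2, map_smul, smul_eq_mul, h5]
  linear_combination (-l (tee B H (rootLin α))) * h4

variable (S : (rootSystem H).Base)

/-- The root `-α`. -/
def negRoot (α : H.root) : H.root := ⟨-α.1, by
  have := H.isNonZero_coe_root α
  simpa using this⟩

@[simp] theorem coe_negRoot (α : H.root) : (negRoot α : Weight ℂ H g) = -α.1 := rfl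

@[simp] theorem negRoot_negRoot (α : H.root) : negRoot (negRoot α) = α := Subtype.ext (neg_neg α.1)

theorem height_negRoot (α : H.root) : S.height (negRoot α) = -S.height α := by
  have h := S.height_reflectionPerm_self α
  have e : (rootSystem H).reflectionPerm α α = negRoot α := by
    apply (rootSystem H).root.injective
    rw [RootPairing.root_reflectionPerm, RootPairing.reflection_apply_self]
    rfl
  rw [← h]
  exact congrArg _ e.symm

theorem isPos_negRoot (α : H.root) : S.IsPos (negRoot α) ↔ ¬ S.IsPos α := by
  rw [RootPairing.Base.isPos_iff, RootPairing.Base.isPos_iff, height_negRoot]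
  have := S.height_ne_zero α
  omega

-- The simple reflection at `i` permutes the positive roots other than `i` and reverses the sign of
-- their pairing with `i`, so those terms cancel in pairs and only the term of `i` survives.
open Classical in
theorem sum_pos_root_apply_tee (i : H.root) (hi : i ∈ S.support) :
    ∑ α : H.root with S.IsPos α, rootLin i.1 (tee B H (rootLin α.1)) =
      rootLin i.1 (tee B H (rootLin i.1)) := by
  rw [← Finset.add_sum_erase _ _ (Finset.mem_filter.mpr
    ⟨Finset.mem_univ i, RootPairing.Base.isPos_of_mem_support hi⟩), add_eq_left]
  have key : ∀ α : H.root,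
      rootLin i.1 (tee B H (rootLin ((rootSystem H).reflectionPerm i α).1)) =
      -rootLin i.1 (tee B H (rootLin α.1)) := by
    intro α
    have h1 : rootLin ((rootSystem H).reflectionPerm i α).1 =
        rootLin α.1 - α.1 (coroot i.1) • rootLin i.1 := by
      have := (rootSystem H).root_reflectionPerm i α
      rw [RootPairing.reflection_apply] at this
      exact this
    have h2 := two_mul_apply_tee (B := B) (H.isNonZero_coe_root i) (rootLin α.1)
    rw [apply_tee_comm] at h2
    rw [h1, map_sub, map_smul, map_sub, map_smul, smul_eq_mul]
    have h3 : rootLin α.1 (coroot i.1) = α.1 (coroot i.1) := rfl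
    have h4 : rootLin i.1 (tee B H (rootLin i.1)) = i.1 (tee B H (rootLin i.1)) := rfl
    rw [h3] at h2
    rw [h4]
    linear_combination h2
  refine Finset.sum_involution (fun α _ => (rootSystem H).reflectionPerm i α) ?_ ?_ ?_ ?_
  · intro α _
    rw [key, add_neg_cancel]
  · intro α _ h0 h1
    have := key α
    rw [h1] at this
    -- A root fixed by the reflection contributes a number equal to its own negative.
    exact h0 (by linear_combination this / 2)
  · intro α hα
    simp only [Finset.mem_erase, Finset.mem_filter, Finset.mem_univ, true_and] at hα ⊢
    have hp := hα.2.reflectionPerm hi hα.1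
    -- The reflected root cannot be `i`: then `α` would be `-i`, which is not positive.
    refine ⟨fun h => ?_, hp⟩
    have e : α = negRoot i := by
      have : (rootSystem H).reflectionPerm i ((rootSystem H).reflectionPerm i α) = α := by simp
      rw [h] at this
      rw [← this]
      apply (rootSystem H).root.injective
      rw [RootPairing.root_reflectionPerm, RootPairing.reflection_apply_self]
      rfl
    exact (isPos_negRoot S i).mp (e ▸ hα.2) (RootPairing.Base.isPos_of_mem_support hi)
  · intro α _
    simp

theorem eq_of_forall_simple_root {h k : H} (hhk : ∀ i ∈ S.support, rootLin i.1 h = rootLin i.1 k) :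
    h = k := by
  rw [← sub_eq_zero, ← Module.forall_dual_apply_eq_zero_iff ℂ]
  intro l
  have hl : l ∈ Submodule.span ℂ ((rootSystem H).root '' S.support) := by
    rw [S.span_root_support, RootPairing.rootSpan, RootPairing.IsRootSystem.span_root_eq_top]
    trivial
  induction hl using Submodule.span_induction with
  | mem l hl =>
    obtain ⟨i, hi, rfl⟩ := hl
    rw [map_sub, sub_eq_zero]
    exact hhk i hi
  | zero => rfl
  | add l m _ _ h1 h2 => simp [LinearMap.add_apply, h1, h2]
  | smul c l _ h1 => simp [LinearMap.smul_apply, h1]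

end Roots

/-! ### Heights and the highest root. -/

section HighestRoot

open LieAlgebra LieAlgebra.IsKilling LieModule

variable {g : Type*} [LieRing g] [LieAlgebra ℂ g] [FiniteDimensional ℂ g] [LieAlgebra.IsSimple ℂ g]
  {B : InvForm g} {H : LieSubalgebra ℂ g} [H.IsCartanSubalgebra]

/-- The height extends to a linear form on `h*`. -/
theorem exists_linear_height (S : (rootSystem H).Base) :
    ∃ φ : Module.Dual ℂ H →ₗ[ℂ] ℂ, (∀ i ∈ S.support, φ ((rootSystem H).root i) = 1) ∧
      ∀ α : H.root, φ (rootLin α.1) = S.height α := by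
  let φ : Module.Dual ℂ H →ₗ[ℂ] ℂ := S.toWeightBasis.constr ℂ fun _ => (1 : ℂ)
  have h1 : ∀ i ∈ S.support, φ ((rootSystem H).root i) = 1 := by
    intro i hi
    have := S.toWeightBasis.constr_basis ℂ (fun _ => (1 : ℂ)) ⟨i, hi⟩
    rwa [RootPairing.Base.toWeightBasis_apply] at this
  refine ⟨φ, h1, fun α => ?_⟩
  obtain ⟨f, -, -, hf⟩ := S.exists_root_eq_sum_int α
  rw [RootPairing.Base.height_eq_sum hf]
  change φ ((rootSystem H).root α) = _
  rw [hf, map_sum, Int.cast_sum]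
  refine Finset.sum_congr rfl fun j hj => ?_
  rw [map_zsmul, h1 j hj]
  simp

variable {S : (rootSystem H).Base} {β : H.root} (hβ : IsHighestRoot S β)
include hβ

theorem IsHighestRoot.height_le (α : H.root) : S.height α ≤ S.height β := by
  obtain ⟨φ, h1, h2⟩ := exists_linear_height S
  have h3 : ∃ n : ℕ, φ ((rootSystem H).root β - (rootSystem H).root α) = n := by
    have hm := hβ α
    generalize (rootSystem H).root β - (rootSystem H).root α = m at hm
    induction hm using AddSubmonoid.closure_induction with
    | mem m hm =>
      obtain ⟨i, hi, rfl⟩ := hm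
      exact ⟨1, by simpa using h1 i hi⟩
    | zero => exact ⟨0, by simp⟩
    | add m m' _ _ hm hm' =>
      obtain ⟨n, hn⟩ := hm
      obtain ⟨n', hn'⟩ := hm'
      exact ⟨n + n', by simp [hn, hn']⟩
  obtain ⟨n, hn⟩ := h3
  change φ (rootLin β.1 - rootLin α.1) = n at hn
  rw [map_sub, h2, h2] at hn
  have : S.height β - S.height α = n := by exact_mod_cast hn
  omega

theorem IsHighestRoot.height_pos : 0 < S.height β := by
  have h1 := hβ.height_le (negRoot β)
  have h2 := S.height_ne_zero β
  rw [height_negRoot] at h1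
  omega

/-- A nonzero bracket would make `α + β` a weight. Its height exceeds that of `β`, so it is nonzero,
hence a root, and contradicts the maximality of `ht β`. -/
theorem IsHighestRoot.lie_eq_zero {α : H.root} (hα : S.IsPos α) {y z : g}
    (hy : y ∈ rootSpace H α.1) (hz : z ∈ rootSpace H β.1) : ⁅y, z⁆ = 0 := by
  have h1 : ⁅y, z⁆ ∈ rootSpace H ((α.1 : H → ℂ) + β.1) :=
    LieAlgebra.lie_mem_genWeightSpace_of_mem_genWeightSpace hy hz
  by_contra h0
  have hne : rootSpace H ((α.1 : H → ℂ) + β.1) ≠ ⊥ := by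
    intro h
    rw [h] at h1
    exact h0 ((LieSubmodule.mem_bot _).mp h1)
  let γ : Weight ℂ H g := ⟨(α.1 : H → ℂ) + β.1, hne⟩
  have hγ : rootLin γ = rootLin α.1 + rootLin β.1 := rfl
  obtain ⟨φ, -, h2⟩ := exists_linear_height S
  have hα' : 0 < S.height α := hα
  have hβ' := hβ.height_pos
  have h3 : φ (rootLin γ) = ((S.height α + S.height β : ℤ) : ℂ) := by
    rw [hγ, map_add, h2, h2]
    push_cast
    rfl
  have h4 : γ.IsNonZero := by
    intro h
    have h5 : rootLin γ = 0 := LinearMap.ext fun k => congrFun h k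
    rw [h5, map_zero] at h3
    have : S.height α + S.height β = 0 := by exact_mod_cast h3.symm
    omega
  have h6 := h2 ⟨γ, by simpa using h4⟩
  rw [h3] at h6
  have h7 : S.height α + S.height β = S.height ⟨γ, by simpa using h4⟩ := by exact_mod_cast h6
  have := hβ.height_le ⟨γ, by simpa using h4⟩
  omega

end HighestRoot

/-! ### The components of `γ⁻¹(ρ)`. -/

section Rho

open LieAlgebra LieAlgebra.IsKilling LieModule

variable {g : Type*} [LieRing g] [LieAlgebra ℂ g] [FiniteDimensional ℂ g] [LieAlgebra.IsSimple ℂ g]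
  (B : InvForm g) {H : LieSubalgebra ℂ g} [H.IsCartanSubalgebra]

theorem gamma_symm_rootBar (α : H.root) :
    (gamma B H).symm (rootBar α) = (tee B H (rootLin α.1), 0, 0) := by
  rw [LinearEquiv.symm_apply_eq]
  refine LinearMap.ext fun p => ?_
  rw [gamma_apply]
  simp [barForm, rootBar, form_tee]

theorem gamma_symm_delta : (gamma B H).symm (delta H) = (0, 1, 0) := by
  rw [LinearEquiv.symm_apply_eq]
  refine LinearMap.ext fun p => ?_
  rw [gamma_apply]
  simp [barForm, delta]

theorem dualForm_eq (l m : Module.Dual ℂ (HBar H)) :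
    dualForm B H l m = m ((gamma B H).symm l) := by
  have h : m = gamma B H ((gamma B H).symm m) := ((gamma B H).apply_symm_apply m).symm
  rw [dualForm]
  conv_rhs => rw [h]
  rw [gamma_apply]
  simp only [barForm, LinearMap.mk₂_apply, B.symm (((gamma B H).symm l).1 : g)]
  ring

variable {B} {S : (rootSystem H).Base} {β : H.root} {ρ : Module.Dual ℂ (HBar H)}

-- Both sides pair in the same way with every simple root, and the simple roots span `h*`.
open Classical in
theorem IsRho.two_smul_cartan_part (hρ : IsRho B S β ρ) :
    (2 : ℂ) • ((gamma B H).symm ρ).1 = ∑ α : H.root with S.IsPos α, tee B H (rootLin α.1) := by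
  refine eq_of_forall_simple_root S fun i hi => ?_
  have h1 := hρ.1 i hi
  rw [dualForm_eq, dualForm_eq, gamma_symm_rootBar] at h1
  change rootLin i.1 ((gamma B H).symm ρ).1 = 1 / 2 * rootLin i.1 (tee B H (rootLin i.1)) at h1
  rw [map_sum, sum_pos_root_apply_tee S i hi, map_smul, h1, smul_eq_mul]
  ring

-- The coefficient of `d` is `(ρ, δ)`. The condition at `α₀`, where `(α₀, α₀) = (β, β)`, gives `(ρ,
-- δ) = (ρ, β) + (β, β)/2`, so twice the coefficient is the Casimir eigenvalue `(β, β + 2ρ)`.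
open Classical in
theorem IsRho.two_mul_derivation_part (hρ : IsRho B S β ρ) :
    2 * ((gamma B H).symm ρ).2.2 = rootLin β.1 (tee B H (rootLin β.1)) +
      ∑ α : H.root with S.IsPos α, rootLin β.1 (tee B H (rootLin α.1)) := by
  have h1 := hρ.2
  rw [dualForm_eq, dualForm_eq, map_sub, gamma_symm_rootBar, gamma_symm_delta] at h1
  have h2 := congrArg (rootLin β.1) hρ.two_smul_cartan_part
  rw [map_sum, map_smul, smul_eq_mul] at h2
  have h3 : rootBar β ((gamma B H).symm ρ) = rootLin β.1 ((gamma B H).symm ρ).1 := rfl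
  have h4 : delta H ((gamma B H).symm ρ) = ((gamma B H).symm ρ).2.2 := rfl
  have h5 : rootBar β ((0, 1, 0) - (tee B H (rootLin β.1), 0, 0)) =
      -rootLin β.1 (tee B H (rootLin β.1)) := by simp [rootBar]
  have h6 : delta H ((0, 1, 0) - (tee B H (rootLin β.1), 0, 0)) = 0 := by simp [delta]
  rw [LinearMap.sub_apply, LinearMap.sub_apply, h3, h4, h5, h6] at h1
  linear_combination 2 * h1 + h2

end Rho

/-! ### The dual bases of `g` adapted to the root decomposition, and their Casimir eigenvalue. -/

section RootBasis

open LieAlgebra LieAlgebra.IsKilling LieModule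

variable {g : Type*} [LieRing g] [LieAlgebra ℂ g] [FiniteDimensional ℂ g] [LieAlgebra.IsSimple ℂ g]
  {B : InvForm g} {H : LieSubalgebra ℂ g} [H.IsCartanSubalgebra]

omit [IsSimple ℂ g] in
theorem induction_root_decomposition {p : g → Prop} (hadd : ∀ y z, p y → p z → p (y + z))
    (hcartan : ∀ k : H, p k) (hroot : ∀ (α : H.root) (z), z ∈ rootSpace H α.1 → p z) (z : g) :
    p z := by
  have h0 : p 0 := hcartan 0
  have hz : z ∈ (H.toLieSubmodule ⊔ ⨆ α : Weight ℂ H g, ⨆ (_ : α.IsNonZero),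
      rootSpace H α : LieSubmodule ℂ H g) := by
    rw [cartan_sup_iSup_rootSpace_eq_top]; trivial
  rw [LieSubmodule.mem_sup] at hz
  obtain ⟨y, hy, w, hw, rfl⟩ := hz
  refine hadd _ _ (hcartan ⟨y, by simpa using hy⟩) ?_
  induction hw using LieSubmodule.iSup_induction' with
  | mem α y hy =>
    by_cases hα : α.IsNonZero
    · rw [iSup_pos hα] at hy
      exact hroot ⟨α, by simpa using hα⟩ y hy
    · rw [iSup_neg hα, LieSubmodule.mem_bot] at hy
      exact hy ▸ h0
  | zero => exact h0
  | add y z _ _ hy hz => exact hadd _ _ hy hz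

variable {x : Weight ℂ H g → g} (hx : ∀ α ∈ H.root, x α ∈ rootSpace H α)
  (hx1 : ∀ α ∈ H.root, B.form (x α) (x (-α)) = 1)
  {ι : Type*} [Fintype ι] [DecidableEq ι] {h : Module.Basis ι ℂ H} {h' : ι → H}
  (hh' : ∀ i j, B.form (h i) (h' j) = if i = j then 1 else 0)

include hh' in
theorem sum_form_smul_cartan (k : H) : ∑ i, B.form k (h i) • h' i = k := by
  rw [← sub_eq_zero]
  refine form_cartan_eq_zero B H _ fun l => ?_
  suffices (cartanForm B H) (∑ i, B.form k (h i) • h' i - k) = 0 from LinearMap.congr_fun this l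
  refine h.ext fun j => ?_
  have h2 : ∀ a b : H, cartanForm B H a b = B.form a b := fun _ _ => rfl
  rw [map_sub, LinearMap.sub_apply, map_sum, LinearMap.sum_apply]
  simp [h2, B.symm (h' _ : g), hh']

/-- The first half of the dual bases of `g` made of dual bases of `h` and root vectors. -/
def lowerFamily (x : Weight ℂ H g → g) (h : ι → H) : ι ⊕ H.root → g :=
  Sum.elim (fun i => (h i : g)) fun α => x (-α.1)

/-- The second half of the dual bases of `g` made of dual bases of `h` and root vectors. -/
def upperFamily (x : Weight ℂ H g → g) (h' : ι → H) : ι ⊕ H.root → g :=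
  Sum.elim (fun i => (h' i : g)) fun α => x α.1

include hx in
theorem rootVector_neg_mem (α : H.root) : x (-α.1) ∈ rootSpace H (-(α.1 : H → ℂ)) :=
  (Weight.coe_neg (α := α.1)) ▸ hx _ (negRoot α).2

-- By linearity `z` may be taken in `h` or in one root space. Weight spaces are orthogonal unless
-- their weights are opposite, so one block of the sum survives: the Cartan block, or a single root
-- vector, which spans its one-dimensional root space.
include hx hx1 hh' in
theorem isDualFamily_root :
    IsDualFamily B (lowerFamily x h) (upperFamily x h') := by
  intro z
  simp only [lowerFamily, upperFamily, Fintype.sum_sum_type, Sum.elim_inl, Sum.elim_inr]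
  induction z using induction_root_decomposition (H := H) with
  | hadd y z hy hz =>
    simp only [map_add, LinearMap.add_apply, add_smul, Finset.sum_add_distrib]
    nth_rewrite 3 [← hy]
    nth_rewrite 3 [← hz]
    abel
  | hcartan k =>
    have h1 : ∀ α : H.root, B.form k (x (-α.1)) = 0 := fun α => by
      refine form_eq_zero_of_rootSpace (H := H) (α := 0) ?_ (rootVector_neg_mem hx α) ?_
      · exact LieAlgebra.toLieSubmodule_le_rootSpace_zero ℂ g H (by simp)
      · simp
    simp only [h1, zero_smul, Finset.sum_const_zero, add_zero]
    have := congrArg Subtype.val (sum_form_smul_cartan hh' k)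
    simpa using this
  | hroot α z hz =>
    have h1 : ∀ k : H, B.form z k = 0 := fun k => by
      refine form_eq_zero_of_rootSpace (H := H) (β := 0) hz ?_ ?_
      · exact LieAlgebra.toLieSubmodule_le_rootSpace_zero ℂ g H (by simp)
      · simp
    have h2 : ∀ γ : H.root, γ ≠ α → B.form z (x (-γ.1)) = 0 := fun γ hγ => by
      refine form_eq_zero_of_rootSpace hz (rootVector_neg_mem hx γ) fun e => hγ ?_
      rw [add_neg_eq_zero] at e
      exact Subtype.ext (DFunLike.coe_injective e.symm)
    have h3 : x α.1 ≠ 0 := fun e => by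
      have := hx1 α.1 α.2
      simp [e] at this
    obtain ⟨c, rfl⟩ : ∃ c : ℂ, c • x α.1 = z := by
      have hf := finrank_rootSpace_eq_one α.1 (H.isNonZero_coe_root α)
      obtain ⟨c, hc⟩ := (finrank_eq_one_iff_of_nonzero' (⟨x α.1, hx _ α.2⟩ : rootSpace H α.1)
        (by simpa [Subtype.ext_iff] using h3)).mp hf ⟨z, hz⟩
      exact ⟨c, congrArg Subtype.val hc⟩
    rw [Finset.sum_eq_single α (fun γ _ hγ => by rw [h2 γ hγ, zero_smul])
      (fun h => absurd (Finset.mem_univ _) h)]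
    simp only [h1, zero_smul, Finset.sum_const_zero, zero_add]
    rw [map_smul, LinearMap.smul_apply, hx1 α.1 α.2, smul_eq_mul, mul_one]

include hx hx1 in
theorem lie_rootVector_neg (α : H.root) : ⁅x α.1, x (-α.1)⁆ = (tee B H (rootLin α.1) : g) := by
  rw [lie_rootSpace_neg (B := B) (hx _ α.2) (rootVector_neg_mem hx α), hx1 _ α.2, one_smul]

open Classical in
theorem sum_eq_sum_pos_add_sum_neg {M : Type*} [AddCommMonoid M] (S : (rootSystem H).Base)
    (f : Weight ℂ H g → M) : ∑ α : H.root, f α.1 =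
      ∑ α : H.root with S.IsPos α, f α.1 + ∑ α : H.root with S.IsPos α, f (-α.1) := by
  rw [← Finset.sum_filter_add_sum_filter_not Finset.univ (fun α : H.root => S.IsPos α)]
  congr 1
  refine Finset.sum_nbij' negRoot negRoot ?_ ?_ ?_ ?_ ?_ <;> simp [isPos_negRoot]

-- It suffices to evaluate on `x_β`. The Cartan terms give `(β, β)`; terms whose inner factor is a
-- positive root vector vanish; each term with inner factor `x_{-α}`, `α > 0`, becomes `[[x_α,
-- x_{-α}], x_β] = (α, β) x_β`.
include hx hx1 hh' in
theorem casimir_root_eq_smul {S : (rootSystem H).Base} {β : H.root} (hβ : IsHighestRoot S β)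
    {ρ : Module.Dual ℂ (HBar H)} (hρ : IsRho B S β ρ) (y : g) :
    casimir (lowerFamily x h) (upperFamily x h') y = (2 * ((gamma B H).symm ρ).2.2) • y := by
  classical
  have hx0 : x β.1 ≠ 0 := fun e => by
    have := hx1 β.1 β.2
    simp [e] at this
  refine casimir_eq_smul (isDualFamily_root hx hx1 hh') hx0 ?_ y
  have hk : ∀ k : H, ⁅(k : g), x β.1⁆ = rootLin β.1 k • x β.1 :=
    fun k => lie_eq_smul_of_mem_rootSpace (hx _ β.2) k
  have h1 : ∑ i, ⁅(h i : g), ⁅(h' i : g), x β.1⁆⁆ =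
      rootLin β.1 (tee B H (rootLin β.1)) • x β.1 := by
    have := congrArg (rootLin β.1) (sum_form_smul_cartan hh' (tee B H (rootLin β.1)))
    rw [← this, map_sum, Finset.sum_smul]
    refine Finset.sum_congr rfl fun i _ => ?_
    rw [hk, lie_smul, hk, smul_smul, map_smul, form_tee, smul_eq_mul, mul_comm]
  have h2 : ∑ α : H.root with S.IsPos α, ⁅x (-α.1), ⁅x α.1, x β.1⁆⁆ = 0 := by
    refine Finset.sum_eq_zero fun α hα => ?_
    rw [hβ.lie_eq_zero (Finset.mem_filter.mp hα).2 (hx _ α.2) (hx _ β.2), lie_zero]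
  have h3 : ∑ α : H.root with S.IsPos α, ⁅x (- -α.1), ⁅x (-α.1), x β.1⁆⁆ =
      (∑ α : H.root with S.IsPos α, rootLin β.1 (tee B H (rootLin α.1))) • x β.1 := by
    rw [Finset.sum_smul]
    refine Finset.sum_congr rfl fun α hα => ?_
    rw [neg_neg, leibniz_lie, lie_rootVector_neg hx hx1,
      hβ.lie_eq_zero (Finset.mem_filter.mp hα).2 (hx _ α.2) (hx _ β.2), lie_zero, add_zero, hk]
  rw [casimir_apply, hρ.two_mul_derivation_part, add_smul, ← h1, ← h3]
  simp only [lowerFamily, upperFamily, Fintype.sum_sum_type, Sum.elim_inl, Sum.elim_inr]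
  rw [sum_eq_sum_pos_add_sum_neg S fun α => ⁅x (-α), ⁅x α, x β.1⁆⁆, h2, zero_add]

end RootBasis

/-! ### Sums over `k ≥ n` of sequences that vanish for large indices. -/

section TailSums

variable {V : Type*} [AddCommGroup V]

/-- The sequence vanishes for all large indices. -/
def IsEventuallyZero (f : ℤ → V) : Prop := ∃ N : ℤ, ∀ n, N ≤ n → f n = 0

/-- The sum `∑_{k ≥ n} f k`. -/
def tail (f : ℤ → V) (n : ℤ) : V := ∑ᶠ k : ℕ, f (n + k)

variable {f f' : ℤ → V}

theorem IsEventuallyZero.add (hf : IsEventuallyZero f) (hf' : IsEventuallyZero f') :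
    IsEventuallyZero fun n => f n + f' n := by
  obtain ⟨N, hN⟩ := hf
  obtain ⟨N', hN'⟩ := hf'
  exact ⟨max N N', fun n hn => by
    simp only [hN n (le_of_max_le_left hn), hN' n (le_of_max_le_right hn), add_zero]⟩

theorem IsEventuallyZero.neg (hf : IsEventuallyZero f) : IsEventuallyZero fun n => -f n := by
  obtain ⟨N, hN⟩ := hf
  exact ⟨N, fun n hn => by simp only [hN n hn, neg_zero]⟩

theorem IsEventuallyZero.shift (hf : IsEventuallyZero f) (m : ℤ) :
    IsEventuallyZero fun n => f (n + m) := by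
  obtain ⟨N, hN⟩ := hf
  exact ⟨N - m, fun n hn => hN _ (by omega)⟩

theorem isEventuallyZero_ite (m : ℤ) (w : V) : IsEventuallyZero fun n => if n = m then w else 0 :=
  ⟨m + 1, fun n hn => if_neg (by omega)⟩

theorem IsEventuallyZero.exists_tail_eq (hf : IsEventuallyZero f) (n : ℤ) :
    ∃ N : ℕ, ∀ M, N ≤ M → tail f n = ∑ k ∈ Finset.range M, f (n + (k : ℕ)) := by
  obtain ⟨N, hN⟩ := hf
  refine ⟨(N - n).toNat, fun M hM => finsum_eq_sum_of_support_subset _ fun k hk => ?_⟩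
  by_contra hkM
  simp only [Finset.coe_range, Set.mem_Iio, not_lt] at hkM
  exact hk (hN _ (by omega))

theorem IsEventuallyZero.finite_support (hf : IsEventuallyZero f) (n : ℤ) :
    (Function.support fun k : ℕ => f (n + k)).Finite := by
  obtain ⟨N, hN⟩ := hf
  refine (Set.finite_lt_nat (N - n).toNat).subset fun k hk => ?_
  by_contra hkM
  simp only [Set.mem_ofPred_eq, not_lt] at hkM
  exact hk (hN _ (by omega))

theorem IsEventuallyZero.finite_pnat (hf : IsEventuallyZero f) :
    {n : ℕ+ | f n ≠ 0}.Finite := by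
  obtain ⟨N, hN⟩ := hf
  refine ((Set.finite_lt_nat N.toNat).preimage PNat.coe_injective.injOn).subset fun k hk => ?_
  by_contra hkM
  simp only [Set.mem_preimage, Set.mem_ofPred_eq, not_lt] at hkM
  exact hk (hN _ (by have := Int.self_le_toNat N; omega))

theorem finsum_pnat_eq_tail (f : ℤ → V) : ∑ᶠ n : ℕ+, f n = tail f 1 := by
  rw [tail, ← finsum_comp_equiv Equiv.pnatEquivNat]
  refine finsum_congr fun n => ?_
  congr 1
  have := n.natPred_add_one
  simp only [Equiv.pnatEquivNat_apply]
  omega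

theorem tail_succ (hf : IsEventuallyZero f) (n : ℤ) : tail f n = f n + tail f (n + 1) := by
  obtain ⟨N, hN⟩ := hf.exists_tail_eq n
  obtain ⟨N', hN'⟩ := hf.exists_tail_eq (n + 1)
  rw [hN (max N N' + 1) (by omega), hN' (max N N') (by omega), Finset.sum_range_succ', add_comm]
  congr 1
  · simp
  · refine Finset.sum_congr rfl fun k _ => congrArg f ?_
    push_cast
    ring

theorem tail_add (hf : IsEventuallyZero f) (hf' : IsEventuallyZero f') (n : ℤ) :
    tail (fun k => f k + f' k) n = tail f n + tail f' n :=
  finsum_add_distrib (hf.finite_support n) (hf'.finite_support n)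

theorem tail_neg (n : ℤ) : tail (fun k => -f k) n = -tail f n := finsum_neg_distrib _

theorem tail_shift (m n : ℤ) : tail (fun k => f (k + m)) n = tail f (n + m) :=
  finsum_congr fun k => congrArg f (by ring)

theorem tail_map {W : Type*} [AddCommGroup W] (φ : V →+ W) (hf : IsEventuallyZero f) (n : ℤ) :
    tail (fun k => φ (f k)) n = φ (tail f n) :=
  (φ.map_finsum (hf.finite_support n)).symm

theorem tail_ite (m n : ℤ) (w : V) :
    tail (fun k => if k = m then w else 0) n = if n ≤ m then w else 0 := by
  split_ifs with h
  · rw [tail, finsum_eq_single _ (m - n).toNat fun k hk => if_neg (by omega)]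
    exact if_pos (by omega)
  · exact (finsum_congr fun k : ℕ => if_neg (by omega)).trans finsum_zero

theorem tail_sum {κ : Type*} [Fintype κ] {F : κ → ℤ → V} (hF : ∀ i, IsEventuallyZero (F i))
    (n : ℤ) : tail (fun k => ∑ i, F i k) n = ∑ i, tail (F i) n :=
  finsum_sum_comm _ _ fun i _ => (hF i).finite_support n

/-- If `f` and `f'` are eventually zero and `f k + f' (m - k)` is constant, then the difference of
the sums of `f` over `[0, m)` and of `f'` over `(0, m]` (taken with signs) is `m` times it. -/
theorem tail_sub_tail_reflect (hf : IsEventuallyZero f) (hf' : IsEventuallyZero f') (m : ℤ) (z : V)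
    (hz : ∀ k, f' k + f (m - k) = z) :
    tail f 0 - tail f m + (tail f' 1 - tail f' (1 + m)) = m • z := by
  -- Raising `j` by one adds `f (m - j - 1)` to the first tail and removes `f' (1 + j)` from the
  -- second. These indices add up to `m`, so the difference grows by `z`. Running `j` over all
  -- integers covers both signs of `m`.
  have key : ∀ j : ℤ, tail f (m - j) - tail f' (1 + j) = tail f m - tail f' 1 + j • z := by
    intro j
    have step : ∀ j : ℤ, tail f (m - (j + 1)) - tail f' (1 + (j + 1)) =
        tail f (m - j) - tail f' (1 + j) + z := fun j => by
      rw [tail_succ hf (m - (j + 1)), tail_succ hf' (1 + j), ← hz (1 + j),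
        show m - (j + 1) + 1 = m - j by ring, show m - (1 + j) = m - (j + 1) by ring,
        show 1 + j + 1 = 1 + (j + 1) by ring]
      abel
    induction j using Int.induction_on with
    | zero => simp
    | succ j hj => rw [step, hj, add_smul, one_smul, add_assoc]
    | pred j hj =>
      have := step (-j - 1)
      rw [sub_add_cancel, hj] at this
      rw [sub_smul, one_smul, ← add_sub_assoc (tail f m - tail f' 1), this, add_sub_cancel_right]
  have := key m
  rw [sub_self] at this
  have h2 : m • z = tail f 0 - tail f' (1 + m) - (tail f m - tail f' 1) := by
    rw [this]; abel
  rw [h2]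
  abel

end TailSums

/-! ### Commutators of loop elements with the modes and with the Sugawara sum. -/

section Operators

variable {g : Type*} [LieRing g] [LieAlgebra ℂ g] {B : InvForm g}
  {A : Type*} [CommRing A] [Algebra ℂ A]
  {V : Type*} [AddCommGroup V] [Module ℂ V] [LieRingModule (A ⊗[ℂ] Tau B) V]
  [LieModule ℂ (A ⊗[ℂ] Tau B) V]

theorem affine_induction {p : Tau B → Prop} (hadd : ∀ y z, p y → p z → p (y + z))
    (hX : ∀ n z, p (Tau.X B n z)) (hK : ∀ c : ℂ, p (c • Tau.K B)) {y : Tau B}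
    (hy : y ∈ Tau.affine B) : p y := by
  obtain ⟨u, f, c⟩ := y
  have hu : u = 0 := hy
  subst hu
  have hf : p (LinearMap.inr ℂ (ℤ →₀ ℂ) ((ℤ →₀ g) × ℂ) (LinearMap.inl ℂ (ℤ →₀ g) ℂ f)) := by
    induction f using Finsupp.induction_linear with
    | zero =>
      rw [map_zero, map_zero]
      have := hK 0
      rwa [zero_smul] at this
    | add f f' h1 h2 => rw [map_add, map_add]; exact hadd _ _ (h1 rfl) (h2 rfl)
    | single n z => exact hX n z
  have e : ((0, f, c) : (ℤ →₀ ℂ) × (ℤ →₀ g) × ℂ) = (0, f, 0) + c • (0, 0, 1) := by simp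
  exact Eq.mpr (congrArg (α := Tau B) p e) (hadd _ _ hf (hK c))

theorem HBar.toTau_apply {H : LieSubalgebra ℂ g} (p : HBar H) :
    HBar.toTau B H p = Tau.X B 0 p.1 + (p.2.1 • Tau.K B + p.2.2 • Tau.L B 0) := by
  simp [HBar.toTau]

theorem op_add (y z : Tau B) (a : A) : op V (y + z) a = op V y a + op V z a := by
  simp [op, TensorProduct.tmul_add]

theorem op_smul (c : ℂ) (y : Tau B) (a : A) : op V (c • y) a = c • op V y a := by
  rw [op, TensorProduct.tmul_smul, map_smul]
  rfl

/-- The operator `y(a)` as a linear function of `y`. -/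
def opLin (a : A) : Tau B →ₗ[ℂ] Module.End ℂ V where
  toFun y := op V y a
  map_add' y z := op_add y z a
  map_smul' c y := op_smul c y a

theorem opLin_apply (a : A) (y : Tau B) : (opLin a y : Module.End ℂ V) = op V y a := rfl

theorem op_op (y z : Tau B) (a b : A) (v : V) :
    op V y a (op V z b v) = op V z b (op V y a v) + op V ⁅y, z⁆ (a * b) v := by
  simp only [op, LieModule.toEnd_apply_apply]
  rw [← LieAlgebra.ExtendScalars.bracket_tmul, lie_lie, add_sub_cancel]

theorem lie_X_X (m n : ℤ) (y z : g) : ⁅Tau.X B m y, Tau.X B n z⁆ =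
    Tau.X B (m + n) ⁅y, z⁆ + (if m + n = 0 then (m : ℂ) * B.form y z else 0) • Tau.K B :=
  Tau.br_X_X B m n y z

theorem op_K_comm (y : Tau B) (a b : A) (v : V) :
    op V y a (op V (Tau.K B) b v) = op V (Tau.K B) b (op V y a v) := by
  rw [op_op, Tau.lie_def, Tau.br_K_right, ← opLin_apply (a * b), map_zero, LinearMap.zero_apply,
    add_zero]

/-- `(w, z) ↦ w ⊗ tᵖ(a) z ⊗ t^q(b) v` as a bilinear map. -/
def loopProd (p : ℤ) (a : A) (q : ℤ) (b : A) (v : V) : g →ₗ[ℂ] g →ₗ[ℂ] V :=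
  LinearMap.mk₂ ℂ (fun w z => op V (Tau.X B p w) a (op V (Tau.X B q z) b v))
    (by simp [op_add]) (by simp [op_smul]) (by simp [op_add]) (by simp [op_smul])

theorem loopProd_apply (p : ℤ) (a : A) (q : ℤ) (b : A) (v : V) (w z : g) :
    loopProd (B := B) p a q b v w z = op V (Tau.X B p w) a (op V (Tau.X B q z) b v) := rfl

variable {κ : Type*} [Fintype κ] {u u' : κ → g}

variable (B V) in
/-- The `n`-th mode `∑ᵢ uᵢ ⊗ t⁻ⁿ(a) u'ᵢ ⊗ tⁿ(b)` of the Sugawara operator. -/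
def mode (u u' : κ → g) (a b : A) (n : ℤ) : Module.End ℂ V :=
  ∑ i, op V (Tau.X B (-n) (u i)) a ∘ₗ op V (Tau.X B n (u' i)) b

theorem mode_apply (a b : A) (n : ℤ) (v : V) : mode B V u u' a b n v =
    ∑ i, op V (Tau.X B (-n) (u i)) a (op V (Tau.X B n (u' i)) b v) := by
  simp [mode, LinearMap.sum_apply]

/-- `∑ᵢ [y, uᵢ] ⊗ tᵐ⁻ⁿ(a) u'ᵢ ⊗ tⁿ(b) v`. -/
def lieMode (B : InvForm g) [LieRingModule (A ⊗[ℂ] Tau B) V]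
    [LieModule ℂ (A ⊗[ℂ] Tau B) V] (u u' : κ → g) (m : ℤ) (y : g) (a b : A) (v : V) (n : ℤ) : V :=
  ∑ i, loopProd (B := B) (m - n) a n b v ⁅y, u i⁆ (u' i)

/-- Moving `y ⊗ tᵐ` past both factors gives two loop terms; by invariance of the dual bases the
second is minus the first with `n` replaced by `n + m`, which is what makes the sum over `n`
telescope. Central terms occur only at `n = m` and `n = -m`, where expanding `y` in the dual bases
collapses them to a single product. -/
theorem op_mode (hu : IsDualFamily B u u') (m : ℤ) (y : g) (a b : A) (v : V) (n : ℤ) :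
    op V (Tau.X B m y) (1 : A) (mode B V u u' a b n v) =
      mode B V u u' a b n (op V (Tau.X B m y) (1 : A) v)
      + lieMode B u u' m y a b v n + -lieMode B u u' m y a b v (n + m)
      + (if n = m then (m : ℂ) • op V (Tau.K B) a (op V (Tau.X B m y) b v) else 0)
      + (if n = -m then (m : ℂ) • op V (Tau.K B) b (op V (Tau.X B m y) a v) else 0) := by
  have e1 : ∀ i, op V (Tau.X B m y) (1 : A)
      (op V (Tau.X B (-n) (u i)) a (op V (Tau.X B n (u' i)) b v)) =
      op V (Tau.X B (-n) (u i)) a (op V (Tau.X B n (u' i)) b (op V (Tau.X B m y) (1 : A) v))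
      + loopProd (B := B) (m - n) a n b v ⁅y, u i⁆ (u' i)
      + loopProd (B := B) (-n) a (m + n) b v (u i) ⁅y, u' i⁆
      + (if n = m then (m : ℂ) else 0) •
          op V (Tau.K B) a (op V (Tau.X B n (B.form y (u i) • u' i)) b v)
      + (if n = -m then (m : ℂ) else 0) •
          op V (Tau.K B) b (op V (Tau.X B (-n) (B.form y (u' i) • u i)) a v) := by
    intro i
    have c1 : (if m + -n = 0 then (m : ℂ) * B.form y (u i) else 0) =
        (if n = m then (m : ℂ) else 0) * B.form y (u i) := by
      rw [ite_mul, zero_mul]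
      exact if_congr (by omega) rfl rfl
    have c2 : (if m + n = 0 then (m : ℂ) * B.form y (u' i) else 0) =
        (if n = -m then (m : ℂ) else 0) * B.form y (u' i) := by
      rw [ite_mul, zero_mul]
      exact if_congr (by omega) rfl rfl
    rw [op_op (Tau.X B m y) (Tau.X B (-n) (u i)), op_op (Tau.X B m y) (Tau.X B n (u' i)),
      lie_X_X, lie_X_X, c1, c2, one_mul, one_mul, op_add, op_add, op_smul, op_smul]
    simp only [loopProd_apply, map_add, map_smul, LinearMap.add_apply, LinearMap.smul_apply,
      op_smul, op_K_comm, smul_smul, ← sub_eq_add_neg]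
    abel
  have e2 : ∑ i, loopProd (B := B) (-n) a (m + n) b v (u i) ⁅y, u' i⁆ =
      -lieMode B u u' m y a b v (n + m) := by
    rw [lieMode, hu.sum_lie, neg_neg, show m - (n + m) = -n by ring, add_comm n m]
  have e3 : ∑ i, op V (Tau.K B) a (op V (Tau.X B n (B.form y (u i) • u' i)) b v) =
      op V (Tau.K B) a (op V (Tau.X B n y) b v) := by
    conv_rhs => rw [← hu y]
    simp only [← opLin_apply, map_sum, LinearMap.sum_apply]
  have e4 : ∑ i, op V (Tau.K B) b (op V (Tau.X B (-n) (B.form y (u' i) • u i)) a v) =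
      op V (Tau.K B) b (op V (Tau.X B (-n) y) a v) := by
    conv_rhs => rw [← hu.symm y]
    simp only [← opLin_apply, map_sum, LinearMap.sum_apply]
  rw [mode_apply, mode_apply, map_sum]
  simp_rw [e1, Finset.sum_add_distrib, ← Finset.smul_sum]
  rw [e2, e3, e4, ← lieMode]
  congr 1
  · congr 1
    by_cases hn : n = m <;> simp [hn]
  · by_cases hn : n = -m <;> simp [hn]

/-- Symmetry of the tensor and invariance of the form show that the sum equals its own negative. -/
theorem sum_form_lie (hu : IsDualFamily B u u') (y : g) : ∑ i, B.form ⁅y, u i⁆ (u' i) = 0 := by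
  let φ : g →ₗ[ℂ] g →ₗ[ℂ] ℂ := B.form ∘ₗ (LieAlgebra.ad ℂ g y : g →ₗ[ℂ] g)
  have h : ∑ i, B.form ⁅y, u i⁆ (u' i) = ∑ i, B.form ⁅y, u' i⁆ (u i) := hu.sum_swap φ
  have h2 : ∑ i, B.form ⁅y, u' i⁆ (u i) = -∑ i, B.form ⁅y, u i⁆ (u' i) := by
    rw [← Finset.sum_neg_distrib]
    refine Finset.sum_congr rfl fun i _ => ?_
    rw [InvForm.form_lie_left, B.symm]
  rw [h2] at h
  linear_combination h / 2

theorem sum_lie_lie (hu : IsDualFamily B u u') (y : g) :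
    ∑ i, ⁅⁅y, u i⁆, u' i⁆ = casimir u u' y := by
  let φ : g →ₗ[ℂ] g →ₗ[ℂ] g := LinearMap.mk₂ ℂ (fun a b => ⁅⁅y, a⁆, b⁆)
    (by simp) (by simp) (by simp) (by simp)
  have h : ∑ i, ⁅⁅y, u i⁆, u' i⁆ = ∑ i, ⁅⁅y, u' i⁆, u i⁆ := hu.sum_swap φ
  rw [h, casimir_apply]
  refine Finset.sum_congr rfl fun i _ => ?_
  rw [← lie_skew, ← lie_skew y, lie_neg, neg_neg]

/-- Exchanging the two factors of the first sum turns its main part into minus the second sum, by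
symmetry and invariance of the tensor. The commutators add up to the Casimir operator applied to
`y`, and their central part vanishes by `sum_form_lie`. This supplies the constant required by
`tail_sub_tail_reflect`. -/
theorem lieMode_add_lieMode (hu : IsDualFamily B u u') (m : ℤ) (y : g) (a b : A) (v : V) (k : ℤ) :
    lieMode B u u' m y b a v k + lieMode B u u' m y a b v (m - k) =
      op V (Tau.X B m (casimir u u' y)) (a * b) v := by
  have e1 : ∀ i, loopProd (B := B) (m - k) b k a v ⁅y, u i⁆ (u' i) =
      loopProd (B := B) k a (m - k) b v (u' i) ⁅y, u i⁆ +
        (op V (Tau.X B m ⁅⁅y, u i⁆, u' i⁆) (a * b) v +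
          (if m = 0 then ((m - k : ℤ) : ℂ) else 0) • B.form ⁅y, u i⁆ (u' i) •
            op V (Tau.K B) (a * b) v) := by
    intro i
    rw [loopProd_apply, op_op, lie_X_X, loopProd_apply, sub_add_cancel, op_add, op_smul,
      mul_comm b a, LinearMap.add_apply, LinearMap.smul_apply, smul_smul, ite_mul, zero_mul]
  let φ : g →ₗ[ℂ] g →ₗ[ℂ] V :=
    (loopProd (B := B) k a (m - k) b v).flip ∘ₗ (LieAlgebra.ad ℂ g y : g →ₗ[ℂ] g)
  have e2 : ∑ i, loopProd (B := B) k a (m - k) b v (u' i) ⁅y, u i⁆ =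
      ∑ i, loopProd (B := B) k a (m - k) b v (u i) ⁅y, u' i⁆ := hu.sum_swap φ
  have e3 := hu.sum_lie (loopProd (B := B) k a (m - k) b v) y
  rw [lieMode, lieMode, sub_sub_cancel, e3]
  simp_rw [e1, Finset.sum_add_distrib, ← Finset.smul_sum, ← Finset.sum_smul]
  rw [e2, sum_form_lie hu, zero_smul, smul_zero, add_zero, ← sum_lie_lie hu]
  simp only [← opLin_apply, map_sum, LinearMap.sum_apply]
  abel

variable (B A V) in
/-- Every vector is annihilated by `z ⊗ tⁿ(a)` for large `n`. -/
def IsLoopRestricted : Prop :=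
  ∀ (v : V) (a : A), ∃ N : ℤ, ∀ n, N ≤ n → ∀ z : g, op V (Tau.X B n z) a v = 0

variable (hV : IsLoopRestricted B A V)
include hV

theorem IsLoopRestricted.op_op (p : ℤ → Tau B) (z : g) (a b : A) (v : V) :
    IsEventuallyZero fun n => op V (p n) a (op V (Tau.X B n z) b v) := by
  obtain ⟨N, hN⟩ := hV v b
  exact ⟨N, fun n hn => by simp only [hN n hn, map_zero]⟩

theorem IsLoopRestricted.mode (a b : A) (v : V) :
    IsEventuallyZero fun n => mode B V u u' a b n v := by
  obtain ⟨N, hN⟩ := hV v b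
  exact ⟨N, fun n hn => by simp [mode_apply, hN n hn]⟩

theorem IsLoopRestricted.lieMode (m : ℤ) (y : g) (a b : A) (v : V) :
    IsEventuallyZero (lieMode B u u' m y a b v) := by
  obtain ⟨N, hN⟩ := hV v b
  exact ⟨N, fun n hn => by simp [AffVir.lieMode, loopProd_apply, hN n hn]⟩

variable (B u u') in
omit hV in
/-- The normally ordered sum of all modes. -/
def sugawara (a b : A) (v : V) : V :=
  mode B V u u' a b 0 v + tail (fun n => mode B V u u' a b n v) 1 +
    tail (fun n => mode B V u u' b a n v) 1

theorem IsLoopRestricted.sugawara_add (a b : A) (v w : V) :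
    sugawara B u u' a b (v + w) = sugawara B u u' a b v + sugawara B u u' a b w := by
  simp only [sugawara, map_add]
  rw [tail_add (hV.mode a b v) (hV.mode a b w), tail_add (hV.mode b a v) (hV.mode b a w)]
  abel

theorem IsLoopRestricted.sugawara_smul (a b : A) (c : ℂ) (v : V) :
    sugawara B u u' a b (c • v) = c • sugawara B u u' a b v := by
  have h : ∀ a b : A, tail (fun n => c • AffVir.mode B V u u' a b n v) 1 =
      c • tail (fun n => AffVir.mode B V u u' a b n v) 1 := fun a b =>
    tail_map (DistribSMul.toAddMonoidHom V c) (hV.mode a b v) 1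
  simp only [sugawara, map_smul, smul_add, h]

theorem IsLoopRestricted.sugawara_op_K (a b c : A) (v : V) :
    sugawara B u u' a b (op V (Tau.K B) c v) = op V (Tau.K B) c (sugawara B u u' a b v) := by
  have h : ∀ (a b : A) (n : ℤ), AffVir.mode B V u u' a b n (op V (Tau.K B) c v) =
      op V (Tau.K B) c (AffVir.mode B V u u' a b n v) := fun a b n => by
    simp only [mode_apply, op_K_comm, map_sum]
  have h' : ∀ a b : A, tail (fun n => op V (Tau.K B) c (AffVir.mode B V u u' a b n v)) 1 =
      op V (Tau.K B) c (tail (fun n => AffVir.mode B V u u' a b n v) 1) := fun a b =>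
    tail_map (op V (Tau.K B) c).toAddMonoidHom (hV.mode a b v) 1
  simp only [sugawara, h, h', map_add]

theorem IsLoopRestricted.op_tail_mode (hu : IsDualFamily B u u') (m : ℤ) (y : g) (a b : A) (v : V) :
    op V (Tau.X B m y) (1 : A) (tail (fun n => AffVir.mode B V u u' a b n v) 1) =
      tail (fun n => AffVir.mode B V u u' a b n (op V (Tau.X B m y) (1 : A) v)) 1
      + tail (AffVir.lieMode B u u' m y a b v) 1 + -tail (AffVir.lieMode B u u' m y a b v) (1 + m)
      + (if 1 ≤ m then (m : ℂ) • op V (Tau.K B) a (op V (Tau.X B m y) b v) else 0)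
      + (if 1 ≤ -m then (m : ℂ) • op V (Tau.K B) b (op V (Tau.X B m y) a v) else 0) := by
  have h1 := hV.mode (u := u) (u' := u') a b (op V (Tau.X B m y) (1 : A) v)
  have h2 := hV.lieMode (u := u) (u' := u') m y a b v
  have h3 := (h2.shift m).neg
  have h4 := isEventuallyZero_ite m ((m : ℂ) • op V (Tau.K B) a (op V (Tau.X B m y) b v))
  have h5 := isEventuallyZero_ite (-m) ((m : ℂ) • op V (Tau.K B) b (op V (Tau.X B m y) a v))
  have h6 := tail_map (op V (Tau.X B m y) (1 : A)).toAddMonoidHom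
    (hV.mode (u := u) (u' := u') a b v) 1
  simp only [LinearMap.toAddMonoidHom_coe] at h6
  rw [← h6]
  simp_rw [op_mode hu]
  rw [tail_add (((h1.add h2).add h3).add h4) h5, tail_add ((h1.add h2).add h3) h4,
    tail_add (h1.add h2) h3, tail_add h1 h2, tail_neg, tail_shift, tail_ite, tail_ite]

/-- With `f`, `f'` the `lieMode` sequences for `(a, b)` and `(b, a)`, the zero mode contributes `f 0
- f m`, which completes the tails of `f` from `1` and `1 + m` to tails from `0` and `m`;
`tail_sub_tail_reflect` then evaluates the whole. -/
theorem IsLoopRestricted.op_sugawara (hu : IsDualFamily B u u') (m : ℤ) (y : g) (a b : A) (v : V) :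
    op V (Tau.X B m y) (1 : A) (sugawara B u u' a b v) =
      sugawara B u u' a b (op V (Tau.X B m y) (1 : A) v)
      + (m : ℂ) • (op V (Tau.K B) a (op V (Tau.X B m y) b v) +
          op V (Tau.K B) b (op V (Tau.X B m y) a v))
      + (m : ℂ) • op V (Tau.X B m (casimir u u' y)) (a * b) v := by
  have hz := tail_sub_tail_reflect (hV.lieMode (u := u) (u' := u') m y a b v)
    (hV.lieMode (u := u) (u' := u') m y b a v) m _ (lieMode_add_lieMode hu m y a b v)
  have h0 := tail_succ (hV.lieMode (u := u) (u' := u') m y a b v) 0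
  have hm := tail_succ (hV.lieMode (u := u) (u' := u') m y a b v) m
  rw [Int.cast_smul_eq_zsmul ℂ m (op V (Tau.X B m (casimir u u' y)) (a * b) v), ← hz, h0, hm,
    sugawara, map_add, map_add, hV.op_tail_mode hu, hV.op_tail_mode hu, op_mode hu, sugawara,
    zero_add, zero_add, add_comm m 1]
  -- The two central terms come one from each tail, at index `m` if `m > 0` and at index `-m` if `m
  -- < 0`, with the roles of `a` and `b` exchanged; for `m = 0` they vanish.
  rcases lt_trichotomy m 0 with h | rfl | h
  · simp only [show ¬ (0 = m) by omega, show ¬ (0 = -m) by omega, show ¬ (1 ≤ m) by omega,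
      show 1 ≤ -m by omega, if_true, if_false, smul_add]
    abel
  · simp
  · simp only [show ¬ (0 = m) by omega, show ¬ (0 = -m) by omega, show 1 ≤ m by omega,
      show ¬ (1 ≤ -m) by omega, if_true, if_false, smul_add]
    abel

end Operators

/-! ### Modules in category `𝒪` are restricted over the loop algebra. -/

section CategoryO

open LieAlgebra LieAlgebra.IsKilling LieModule

variable {g : Type*} [LieRing g] [LieAlgebra ℂ g] [FiniteDimensional ℂ g] [LieAlgebra.IsSimple ℂ g]
  {B : InvForm g} {H : LieSubalgebra ℂ g} [H.IsCartanSubalgebra]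

omit [FiniteDimensional ℂ g] [IsSimple ℂ g] [H.IsCartanSubalgebra] in
theorem X_mem_tauWeight {n : ℤ} {z : g} {l : Module.Dual ℂ (HBar H)}
    (hz : ∀ p : HBar H, ⁅(p.1 : g), z⁆ + (p.2.2 * n) • z = l p • z) :
    Tau.X B n z ∈ tauWeight B l := by
  intro p
  rw [HBar.toTau_apply, ← map_smul (Tau.X B n), ← hz p]
  simp only [add_lie, smul_lie, Tau.lie_def, Tau.br_X_X, Tau.br_K_left, Tau.br_L_X]
  simp [smul_smul]

variable {S : (rootSystem H).Base} {β : H.root} {A : Type*} [CommRing A] [Algebra ℂ A]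
  {V : Type*} [AddCommGroup V] [Module ℂ V] [LieRingModule (A ⊗[ℂ] Tau B) V]
  [LieModule ℂ (A ⊗[ℂ] Tau B) V]

theorem IsCategoryO.isLoopRestricted (hV : IsCategoryO B A V S β) (hβ : IsHighestRoot S β) :
    IsLoopRestricted B A V := by
  intro v a
  obtain ⟨N, hN⟩ := hV.locallyNilpotent v a
  have hpos := hβ.height_pos
  -- Every root satisfies `ht α ≥ -ht β`, so for `n ≥ 1` both `α + nδ` and `nδ` have height at least
  -- `n - ht β`. The bound `1` makes these affine roots positive.
  refine ⟨max 1 (N + S.height β), fun n hn z => ?_⟩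
  have hn1 : 1 ≤ n := le_of_max_le_left hn
  have hn2 : N + S.height β ≤ n := le_of_max_le_right hn
  have hn3 : n ≤ n * (S.height β + 1) := le_mul_of_one_le_right (by omega) (by omega)
  induction z using induction_root_decomposition (H := H) with
  | hadd y z hy hz => rw [map_add, op_add, LinearMap.add_apply, hy, hz, add_zero]
  | hcartan k =>
    refine hN (.imag n (by omega)) (by change 0 < n; omega)
      (by change N ≤ n * (S.height β + 1); omega) _ (X_mem_tauWeight fun p => ?_)
    have h1 : ⁅(p.1 : g), (k : g)⁆ = 0 := by
      have := congrArg Subtype.val (trivial_lie_zero H H p.1 k)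
      simpa using this
    have h2 : (AffineRoot.imag (H := H) n (by omega)).toDual p = p.2.2 * n := by
      simp [AffineRoot.toDual, delta, mul_comm]
    rw [h1, h2, zero_add]
  | hroot α z hz =>
    have h0 := hβ.height_le (negRoot α)
    rw [height_negRoot] at h0
    refine hN (.real α n) (Or.inl (by omega))
      (by change N ≤ S.height α + n * (S.height β + 1); omega) _ (X_mem_tauWeight fun p => ?_)
    have h1 : ⁅(p.1 : g), z⁆ = rootLin α.1 p.1 • z := lie_eq_smul_of_mem_rootSpace hz p.1
    have h2 : (AffineRoot.real α n).toDual p = rootLin α.1 p.1 + p.2.2 * n := by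
      simp [AffineRoot.toDual, delta, rootBar, mul_comm]
    rw [h1, h2, add_smul]

end CategoryO

/-! ### Rewriting `Ω(a,b)` as a Sugawara sum with corrections. -/

section Omega

open LieAlgebra LieAlgebra.IsKilling LieModule

variable {g : Type*} [LieRing g] [LieAlgebra ℂ g] [FiniteDimensional ℂ g] [LieAlgebra.IsSimple ℂ g]
  {B : InvForm g} {H : LieSubalgebra ℂ g} [H.IsCartanSubalgebra]
  {A : Type*} [CommRing A] [Algebra ℂ A]
  {V : Type*} [AddCommGroup V] [Module ℂ V] [LieRingModule (A ⊗[ℂ] Tau B) V]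
  [LieModule ℂ (A ⊗[ℂ] Tau B) V] {ι : Type*} [Fintype ι]
  {x : Weight ℂ H g → g} {h h' : ι → H}

theorem mode_family_eq (a b : A) (n : ℤ) (v : V) :
    mode B V (lowerFamily x h) (upperFamily x h') a b n v =
      ∑ i, cartanTerm B (h i) (h' i) a b n v + ∑ α : H.root, rootTerm B x a b α n v := by
  rw [mode_apply, Fintype.sum_sum_type]
  rfl

/-- The terms `x_α(a) x_{-α}(b)` with `α > 0` are in the wrong order for `Ω³`; reordering them costs
`[x_α, x_{-α}](ab)`, and these elements add up to twice the Cartan part of `γ⁻¹(ρ)`. -/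
theorem mode_zero_family_eq (hx : ∀ α ∈ H.root, x α ∈ rootSpace H α)
    (hx1 : ∀ α ∈ H.root, B.form (x α) (x (-α)) = 1) {S : (rootSystem H).Base} {β : H.root}
    {ρ : Module.Dual ℂ (HBar H)} (hρ : IsRho B S β ρ) (a b : A) (v : V) :
    mode B V (lowerFamily x h) (upperFamily x h') a b 0 v =
      ∑ i, cartanTerm B (h i) (h' i) a b 0 v + omega3 B S x a b v + omega3 B S x b a v +
        (2 : ℂ) • op V (Tau.X B 0 ((gamma B H).symm ρ).1) (a * b) v := by
  classical
  have h1 : ∀ α : H.root, rootTerm B x a b (-α.1) 0 v =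
      rootTerm B x b a α.1 0 v + op V (Tau.X B 0 (tee B H (rootLin α.1))) (a * b) v := by
    intro α
    simp only [rootTerm, neg_neg, neg_zero]
    rw [op_op, lie_X_X, lie_rootVector_neg hx hx1]
    simp
  have h2 : (2 : ℂ) • op V (Tau.X B 0 ((gamma B H).symm ρ).1) (a * b) v =
      ∑ α : H.root with S.IsPos α, op V (Tau.X B 0 (tee B H (rootLin α.1))) (a * b) v := by
    have := congrArg (fun k : H => opLin (a * b) (Tau.X B 0 (H.toSubmodule.subtype k)) v)
      hρ.two_smul_cartan_part
    simp only [map_smul, map_sum, LinearMap.smul_apply, LinearMap.sum_apply] at this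
    exact this
  rw [mode_family_eq, sum_eq_sum_pos_add_sum_neg S fun α => rootTerm B x a b α 0 v, h2]
  simp_rw [h1, Finset.sum_add_distrib]
  rw [omega3, omega3]
  simp only [add_assoc]

theorem IsLoopRestricted.omega1_add_omega2 (hV : IsLoopRestricted B A V) (a b : A) (v : V) :
    omega1 B x a b v + omega2 B h h' a b v =
      tail (fun n => AffVir.mode B V (lowerFamily x h) (upperFamily x h') a b n v) 1 := by
  have h1 : ∀ i, IsEventuallyZero fun n => cartanTerm B (h i) (h' i) a b n v :=
    fun i => hV.op_op _ _ _ _ _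
  have h2 : ∀ α : H.root, IsEventuallyZero fun n => rootTerm B x a b α n v :=
    fun α => hV.op_op _ _ _ _ _
  have h3 : omega1 B x a b v = ∑ α : H.root, tail (fun n => rootTerm B x a b α n v) 1 :=
    Finset.sum_congr rfl fun α _ => finsum_pnat_eq_tail fun n => rootTerm B x a b α n v
  have h4 : omega2 B h h' a b v = ∑ i, tail (fun n => cartanTerm B (h i) (h' i) a b n v) 1 :=
    Finset.sum_congr rfl fun i _ => finsum_pnat_eq_tail fun n => cartanTerm B (h i) (h' i) a b n v
  rw [h3, h4, ← tail_sum h1, ← tail_sum h2, add_comm, ← tail_add]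
  · simp_rw [mode_family_eq]
  -- The vanishing of a mode for large `n` needs no duality, so it applies to the Cartan vectors
  -- alone and, below, to the root vectors alone.
  · obtain h3 := hV.mode (u := fun i => (h i : g)) (u' := fun i => (h' i : g)) a b v
    simp_rw [mode_apply] at h3
    exact h3
  · obtain h3 := hV.mode (u := fun α : H.root => x (-α.1)) (u' := fun α => x α.1) a b v
    simp_rw [mode_apply] at h3
    exact h3

/-- The zero mode absorbs the Cartan part of `2γ⁻¹(ρ)(ab)`; only its components along `K` and `d`
remain visible. -/
theorem IsLoopRestricted.omega_eq (hV : IsLoopRestricted B A V)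
    (hx : ∀ α ∈ H.root, x α ∈ rootSpace H α)
    (hx1 : ∀ α ∈ H.root, B.form (x α) (x (-α)) = 1) {S : (rootSystem H).Base} {β : H.root}
    {ρ : Module.Dual ℂ (HBar H)} (hρ : IsRho B S β ρ) (a b : A) (v : V) :
    omega B S ρ x h h' a b v =
      sugawara B (lowerFamily x h) (upperFamily x h') a b v
      + op V (Tau.K B) a (op V (Tau.L B 0) b v) + op V (Tau.K B) b (op V (Tau.L B 0) a v)
      + (2 * ((gamma B H).symm ρ).2.1) • op V (Tau.K B) (a * b) v
      + (2 * ((gamma B H).symm ρ).2.2) • op V (Tau.L B 0) (a * b) v := by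
  rw [sugawara, ← hV.omega1_add_omega2, ← hV.omega1_add_omega2, mode_zero_family_eq hx hx1 hρ,
    omega, HBar.toTau_apply]
  simp only [op_add, op_smul, LinearMap.add_apply, LinearMap.smul_apply, smul_add, smul_smul]
  abel

end Omega

end AffVir

end

/-! ### The proposition. -/

open AffVir in
theorem proposition3p1
    {g : Type*} [LieRing g] [LieAlgebra ℂ g] [FiniteDimensional ℂ g] [LieAlgebra.IsSimple ℂ g]
    (B : InvForm g) (H : LieSubalgebra ℂ g) [H.IsCartanSubalgebra]
    (S : (LieAlgebra.IsKilling.rootSystem H).Base) (β : H.root) (hβ : IsHighestRoot S β)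
    (ρ : Module.Dual ℂ (HBar H)) (hρ : IsRho B S β ρ)
    (x : LieModule.Weight ℂ H g → g)
    (hx : ∀ α ∈ H.root, x α ∈ LieAlgebra.rootSpace H α)
    (hx1 : ∀ α ∈ H.root, B.form (x α) (x (-α)) = 1)
    {ι : Type*} [Fintype ι] [DecidableEq ι] (h : Module.Basis ι ℂ H) (h' : ι → H)
    (hh' : ∀ i j, B.form (h i) (h' j) = if i = j then 1 else 0)
    (A : Type*) [CommRing A] [Algebra ℂ A] [Algebra.FiniteType ℂ A]
    (V : Type*) [AddCommGroup V] [Module ℂ V] [LieRingModule (A ⊗[ℂ] Tau B) V]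
    [LieModule ℂ (A ⊗[ℂ] Tau B) V] (hV : IsCategoryO B A V S β) :
    -- the infinite sums are finite on every vector
    (∀ (a b : A) (v : V),
      (∀ α ∈ H.root, {n : ℕ+ | rootTerm B x a b α n v ≠ 0}.Finite) ∧
      ∀ i, {n : ℕ+ | cartanTerm B (h i) (h' i) a b n v ≠ 0}.Finite) ∧
    ∀ a b : A,
      IsLinearMap ℂ (fun v : V => omega B S ρ x h h' a b v) ∧
      ∀ y ∈ Tau.affine B, ∀ v : V,
        omega B S ρ x h h' a b (op V y (1 : A) v) = op V y (1 : A) (omega B S ρ x h h' a b v) := by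
  have hR := hV.isLoopRestricted hβ
  refine ⟨fun a b v => ⟨fun α _ => ?_, fun i => ?_⟩, fun a b => ?_⟩
  · exact IsEventuallyZero.finite_pnat (f := fun n => rootTerm B x a b α n v)
      (hR.op_op _ _ _ _ _)
  · exact IsEventuallyZero.finite_pnat (f := fun n => cartanTerm B (h i) (h' i) a b n v)
      (hR.op_op _ _ _ _ _)
  have hlin : IsLinearMap ℂ (fun v : V => omega B S ρ x h h' a b v) := by
    constructor
    · intro v w
      simp only [hR.omega_eq hx hx1 hρ, hR.sugawara_add, map_add, smul_add]
      abel
    · intro c v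
      simp only [hR.omega_eq hx hx1 hρ, hR.sugawara_smul, map_smul, smul_add, smul_comm _ c]
  refine ⟨hlin, fun y hy => ?_⟩
  refine affine_induction (p := fun y => ∀ v : V, omega B S ρ x h h' a b (op V y (1 : A) v) =
    op V y (1 : A) (omega B S ρ x h h' a b v)) (fun y z hy hz v => ?_) (fun m z v => ?_)
    (fun c v => ?_) hy
  · rw [op_add, LinearMap.add_apply, LinearMap.add_apply, ← hy, ← hz]
    exact hlin.map_add _ _
  · have hL : ⁅Tau.X B m z, Tau.L B 0⁆ = (-m : ℂ) • Tau.X B m z := by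
      rw [Tau.lie_def, Tau.br_X_L, zero_add, neg_smul]
    have hXL : ∀ (a : A) (w : V), op V (Tau.X B m z) (1 : A) (op V (Tau.L B 0) a w) =
        op V (Tau.L B 0) a (op V (Tau.X B m z) (1 : A) w) +
          (-m : ℂ) • op V (Tau.X B m z) a w := fun a w => by
      rw [op_op, hL, one_mul, op_smul, LinearMap.smul_apply]
    rw [hR.omega_eq hx hx1 hρ, hR.omega_eq hx hx1 hρ]
    simp only [map_add, map_smul, op_K_comm, hXL,
      hR.op_sugawara (isDualFamily_root hx hx1 hh'), casimir_root_eq_smul hx hx1 hh' hβ hρ,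
      op_smul, LinearMap.smul_apply]
    -- The terms with `K(a)` and `K(b)` cancel those produced by commuting past `d(b)` and `d(a)`;
    -- the Casimir term cancels the one from `2e d(ab)`, the eigenvalue being the same `2e`.
    module
  · rw [op_smul, LinearMap.smul_apply, LinearMap.smul_apply]
    refine (hlin.map_smul _ _).trans (congrArg _ ?_)
    rw [hR.omega_eq hx hx1 hρ, hR.omega_eq hx hx1 hρ, hR.sugawara_op_K]
    simp only [op_K_comm (Tau.L B 0), op_K_comm (Tau.K B) _ (1 : A), map_add, map_smul]
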